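/- **Theorem 2.4.** Let $K$ be a field and $A$ a unital associative $K$-algebra with product $m$ and unit $1_A$. Let $\sigma\colon A\otimes A\to A\otimes A$ be a bijective linear map such that, with $\sigma_1=\sigma\otimes\mathrm{id}_A$ and $\sigma_2=\mathrm{id}_A\otimes\sigma$ on $A^{\otimes 3}$, $$\sigma_1\sigma_2\sigma_1=\sigma_2\sigma_1\sigma_2,\quad (\mathrm{id}_A\otimes m)\sigma_1\sigma_2=\sigma(m\otimes\mathrm{id}_A),\quad (m\otimes\mathrm{id}_A)\sigma_2\sigma_1=\sigma(\mathrm{id}_A\otimes m),$$ and $\sigma(a\otimes 1_A)=1_A\otimes a$, $\sigma(1_A\otimes a)=a\otimes 1_A$ for all $a\in A$ (that is, $(A,m,1_A,\sigma)$ is a unital braided algebra). Let $\lambda\in K$. Let $T(A)=\bigoplus_{n\ge 0}A^{\otimes n}$ be the tensor algebra. On $A^{\otimes n}$ let $\sigma_k=\mathrm{id}_A^{\otimes (k-1)}\otimes\sigma\otimes\mathrm{id}_A^{\otimes (n-k-1)}$. For $i,j\ge 0$ let $\chi_{ij}\in\mathfrak S_{i+j}$ be the permutation with $\chi_{ij}(p)=p+j$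 for $p\le i$ and $\chi_{ij}(p)=p-i$ for $p>i$, and let $\beta_{ij}\colon A^{\otimes i}\otimes A^{\otimes j}\to A^{\otimes j}\otimes A^{\otimes i}$ be the operator $\sigma_{k_1}\cdots\sigma_{k_l}$ on $A^{\otimes(i+j)}$, where $s_{k_1}\cdots s_{k_l}$ is a reduced expression of $\chi_{ij}$ in the transpositions $s_k=(k\;k+1)$; explicitly $$\beta_{ij}=(\sigma_j\cdots\sigma_{j+i-1})\cdots(\sigma_2\cdots\sigma_{i+1})(\sigma_1\cdots\sigma_i).$$ Let $\beta$ be the linear map on $T(A)\otimes T(A)$ with components $\beta_{ij}$; it maps $T(A)\otimes A$ to $A\otimes T(A)$. Let $\Join_{\sigma,\lambda}\colon T(A)\otimes T(A)\to T(A)$ be the quantum quasi-shuffle product of $(A,\lambda m,\sigma)$: scalars act by multiplication, and for $a,b\in A$, $x\in A^{\otimes i}$, $y\in A^{\otimes j}$ with $i,j\ge 0$, $$(a\otimes x)\Join_{\sigma,\lambda}(b\otimes y)=a\otimes\big(x\Join_{\sigma,\lambda}(b\otimes y)\big)+(\mathrm{id}_A\otimes\Join_{\sigma,\lambda})(\beta_{i+1,1}\otimes\mathrm{id})(a\otimes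 x\otimes b\otimes y)+(\lambda m\otimes\Join_{\sigma,\lambda})(\mathrm{id}_A\otimes\beta_{i,1}\otimes\mathrm{id})(a\otimes x\otimes b\otimes y).$$ On $R=\mathcal R_{\sigma,\lambda}(A)=A\otimes T(A)$ put $\lozenge_{\sigma,\lambda}=(m\otimes\Join_{\sigma,\lambda})(\mathrm{id}_A\otimes\beta\otimes\mathrm{id}_{T(A)})$, and let $P\colon R\to R$ be the linear map $P(a_0\otimes u)=1_A\otimes(a_0\otimes u)$, where $a_0\otimes u$ on the right is the product of $a_0$ and $u$ in $T(A)$. Then $(R,\lozenge_{\sigma,\lambda})$ is an associative algebra with unit $1_A\otimes 1$, and $(R,P)$ is a Rota–Baxter algebra of weight $\lambda$: for all $x,y\in R$, $$P(x)\lozenge_{\sigma,\lambda} P(y)=P\big(x\lozenge_{\sigma,\lambda} P(y)\big)+P\big(P(x)\lozenge_{\sigma,\lambda} y\big)+\lambda P\big(x\lozenge_{\sigma,\lambda} y\big).$$ Moreover, if $A$ is commutative and $\sigma$ is the flip $a\otimes b\mapsto b\otimes a$, then $(R,P)$ is the free commutative unital Rota–Baxter algebra of weight $\lambda$ on $A$: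 $\lozenge_{\sigma,\lambda}$ is commutative, $a\mapsto a\otimes 1$ is a unital algebra homomorphism $A\to R$, and for every commutative unital $K$-algebra $B$ with a Rota–Baxter operator $Q$ of weight $\lambda$ and every unital algebra homomorphism $f\colon A\to B$ there is exactly one unital algebra homomorphism $g\colon R\to B$ with $g\circ P=Q\circ g$ and $g(a\otimes 1)=f(a)$ for all $a\in A$. -/

import Mathlib

open scoped TensorProduct

namespace QuasiShuffle

section Words

/-- The word `(s_j ⋯ s_{j+i-1}) ⋯ (s_2 ⋯ s_{i+1}) (s_1 ⋯ s_i)` in the adjacent transpositions, the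
letter `k` standing for `s_{k+1}`, which exchanges the positions `k` and `k + 1` (counted from `0`).
It is a reduced expression of the block permutation `χ_{ij}`, which sends `p` to `p + j` for
`p < i` and to `p - i` for `i ≤ p < i + j`: see `blockWord_prod`, `blockWord_length` (`χ_{ij}` has
`i * j` inversions). -/
def blockWord (i j : ℕ) : List ℕ :=
  ((List.range j).reverse.map fun k => List.range' k i).flatten

theorem range'_prod (i : ℕ) : ∀ k p : ℕ,
    ((List.range' k i).map fun a => Equiv.swap a (a + 1)).prod p =
      if p = k + i then k else if k ≤ p ∧ p < k + i then p + 1 else p := by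
  induction i with
  | zero =>
    intro k p
    simp only [List.range'_zero, List.map_nil, List.prod_nil, Equiv.Perm.one_apply]
    split_ifs <;> omega
  | succ i ih =>
    intro k p
    rw [List.range'_succ, List.map_cons, List.prod_cons, Equiv.Perm.mul_apply, ih]
    simp only [Equiv.swap_apply_def]
    split_ifs <;> omega

theorem blockWord_prod (i j p : ℕ) :
    ((blockWord i j).map fun a => Equiv.swap a (a + 1)).prod p =
      if p < i then p + j else if p < i + j then p - i else p := by
  induction j generalizing p with
  | zero =>
    have h : blockWord i 0 = [] := by simp [blockWord]
    rw [h, List.map_nil, List.prod_nil, Equiv.Perm.one_apply]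
    split_ifs <;> omega
  | succ j ih =>
    have h : blockWord i (j + 1) = List.range' j i ++ blockWord i j := by
      simp [blockWord, List.range_succ]
    rw [h, List.map_append, List.prod_append, Equiv.Perm.mul_apply, ih, range'_prod]
    split_ifs <;> omega

theorem blockWord_length (i j : ℕ) : (blockWord i j).length = i * j := by
  induction j with
  | zero => simp [blockWord]
  | succ j ih =>
    have h : blockWord i (j + 1) = List.range' j i ++ blockWord i j := by
      simp [blockWord, List.range_succ]
    rw [h, List.length_append, ih, List.length_range', Nat.mul_succ, Nat.add_comm]

end Words

noncomputable section

variable {K : Type*} [Field K]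

section Pow

variable {V : Type*} [AddCommGroup V] [Module K V]

/-- `V^{⊗1} = V`. -/
def oneEquiv (K V : Type*) [Field K] [AddCommGroup V] [Module K V] : (⨂[K]^1 V) ≃ₗ[K] V :=
  PiTensorProduct.subsingletonEquiv (0 : Fin 1)

/-- `V ⊗ V^{⊗n} = V^{⊗(n+1)}`, splitting off the first letter. -/
def headEquiv (K V : Type*) [Field K] [AddCommGroup V] [Module K V] (n : ℕ) :
    V ⊗[K] (⨂[K]^n V) ≃ₗ[K] (⨂[K]^(n + 1) V) :=
  (TensorProduct.congr (oneEquiv K V).symm (LinearEquiv.refl K _)).trans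
    (TensorPower.mulEquiv.trans (TensorPower.cast K V (Nat.add_comm 1 n)))

/-- `f ⊗ id_W` on `V ⊗ (V ⊗ W)`, for an endomorphism `f` of `V ⊗ V`. -/
def onFirstTwo (f : V ⊗[K] V →ₗ[K] V ⊗[K] V) (W : Type*) [AddCommGroup W] [Module K W] :
    V ⊗[K] (V ⊗[K] W) →ₗ[K] V ⊗[K] (V ⊗[K] W) :=
  (TensorProduct.assoc K V V W).toLinearMap ∘ₗ f.rTensor W ∘ₗ
    (TensorProduct.assoc K V V W).symm.toLinearMap

/-- The operator `σ_{k+1} = id^{⊗k} ⊗ σ ⊗ id^{⊗(n-k-2)}` on `V^{⊗n}`, for `k + 2 ≤ n`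
(and the identity for the other `k`, which are never used). -/
def sigmaAt (σ : V ⊗[K] V →ₗ[K] V ⊗[K] V) : (k n : ℕ) → Module.End K (⨂[K]^n V)
  | 0, n + 2 =>
      let e := (TensorProduct.congr (LinearEquiv.refl K V) (headEquiv K V n)).trans
        (headEquiv K V (n + 1))
      e.toLinearMap ∘ₗ onFirstTwo σ (⨂[K]^n V) ∘ₗ e.symm.toLinearMap
  | k + 1, n + 1 =>
      (headEquiv K V n).toLinearMap ∘ₗ (sigmaAt σ k n).lTensor V ∘ₗ
        (headEquiv K V n).symm.toLinearMap
  | _, _ => LinearMap.id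

/-- The operator `σ_{k_1+1} ⋯ σ_{k_l+1}` on `V^{⊗n}` attached to a word `[k_1, …, k_l]`. -/
def wordOp (σ : V ⊗[K] V →ₗ[K] V ⊗[K] V) (n : ℕ) (w : List ℕ) : Module.End K (⨂[K]^n V) :=
  (w.map fun k => sigmaAt σ k n).prod

/-- The component `β_{ij}` of the braiding `β` of the tensor algebra: the lift `T^σ_w` of the block
permutation `w = χ_{ij}`, as a map from `V^{⊗i} ⊗ V^{⊗j}` to `V^{⊗j} ⊗ V^{⊗i}`. -/
def blockBraid (σ : V ⊗[K] V →ₗ[K] V ⊗[K] V) (i j : ℕ) :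
    (⨂[K]^i V) ⊗[K] (⨂[K]^j V) →ₗ[K] (⨂[K]^j V) ⊗[K] (⨂[K]^i V) :=
  (TensorPower.mulEquiv (n := j) (m := i)).symm.toLinearMap ∘ₗ
    (TensorPower.cast K V (Nat.add_comm i j)).toLinearMap ∘ₗ
      wordOp σ (i + j) (blockWord i j) ∘ₗ (TensorPower.mulEquiv (n := i) (m := j)).toLinearMap

/-- `β_{i1}`, seen as a map `V^{⊗i} ⊗ V → V ⊗ V^{⊗i}`. -/
def letterBraid (σ : V ⊗[K] V →ₗ[K] V ⊗[K] V) (i : ℕ) :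
    (⨂[K]^i V) ⊗[K] V →ₗ[K] V ⊗[K] (⨂[K]^i V) :=
  (oneEquiv K V).toLinearMap.rTensor _ ∘ₗ blockBraid σ i 1 ∘ₗ
    (oneEquiv K V).symm.toLinearMap.lTensor _

/-- The restriction `T(V) ⊗ V → V ⊗ T(V)` of the braiding `β` of the tensor algebra. -/
def tensorBraid (σ : V ⊗[K] V →ₗ[K] V ⊗[K] V) :
    TensorAlgebra K V ⊗[K] V →ₗ[K] V ⊗[K] TensorAlgebra K V :=
  TensorProduct.lift
    ((DirectSum.toModule K ℕ (V →ₗ[K] V ⊗[K] TensorAlgebra K V) fun i =>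
        TensorProduct.curry
          ((TensorPower.toTensorAlgebra (n := i)).lTensor V ∘ₗ letterBraid σ i)) ∘ₗ
      TensorAlgebra.equivDirectSum.toLinearMap)

/-- `b ⊗ id_W`, as a map `X ⊗ (V ⊗ W) → V ⊗ (X ⊗ W)`. -/
def through {X : Type*} [AddCommGroup X] [Module K X] (b : X ⊗[K] V →ₗ[K] V ⊗[K] X)
    (W : Type*) [AddCommGroup W] [Module K W] :
    X ⊗[K] (V ⊗[K] W) →ₗ[K] V ⊗[K] (X ⊗[K] W) :=
  (TensorProduct.assoc K V X W).toLinearMap ∘ₗ b.rTensor W ∘ₗ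
    (TensorProduct.assoc K X V W).symm.toLinearMap

/-- Concatenation `V ⊗ T(V) → T(V)`, `a ⊗ u ↦ a u`. -/
def consMap (K V : Type*) [Field K] [AddCommGroup V] [Module K V] :
    V ⊗[K] TensorAlgebra K V →ₗ[K] TensorAlgebra K V :=
  LinearMap.mul' K (TensorAlgebra K V) ∘ₗ (TensorAlgebra.ι K).rTensor _

/-- The component `V^{⊗i} ⊗ V^{⊗j} → T(V)` of the quantum quasi-shuffle product built from a
braiding `σ` and a product `μ` on `V`: scalars act by scalar multiplication, and
`(a x) ⋈ (b y) = a (x ⋈ (b y)) + (id ⊗ ⋈)(β ⊗ id)(a x ⊗ b ⊗ y) + (μ ⊗ ⋈)(id ⊗ β ⊗ id)(a ⊗ x ⊗ b ⊗ y)`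
for letters `a`, `b` and words `x`, `y`. -/
def qshPow (σ : V ⊗[K] V →ₗ[K] V ⊗[K] V) (μ : V ⊗[K] V →ₗ[K] V) :
    (i j : ℕ) → (⨂[K]^i V) ⊗[K] (⨂[K]^j V) →ₗ[K] TensorAlgebra K V
  | 0, j =>
      TensorPower.toTensorAlgebra ∘ₗ (TensorProduct.lid K (⨂[K]^j V)).toLinearMap ∘ₗ
        (TensorPower.algebraMap₀ (R := K) (M := V)).symm.toLinearMap.rTensor _
  | i + 1, 0 =>
      TensorPower.toTensorAlgebra ∘ₗ (TensorProduct.rid K (⨂[K]^(i + 1) V)).toLinearMap ∘ₗ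
        (TensorPower.algebraMap₀ (R := K) (M := V)).symm.toLinearMap.lTensor _
  | i + 1, j + 1 =>
      consMap K V ∘ₗ (qshPow σ μ i (j + 1)).lTensor V ∘ₗ
          (TensorProduct.assoc K V (⨂[K]^i V) (⨂[K]^(j + 1) V)).toLinearMap ∘ₗ
            (headEquiv K V i).symm.toLinearMap.rTensor _ +
        consMap K V ∘ₗ (qshPow σ μ (i + 1) j).lTensor V ∘ₗ
          through (letterBraid σ (i + 1)) (⨂[K]^j V) ∘ₗ
            (headEquiv K V j).symm.toLinearMap.lTensor _ +
        consMap K V ∘ₗ TensorProduct.map μ (qshPow σ μ i j) ∘ₗ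
          (TensorProduct.assoc K V V ((⨂[K]^i V) ⊗[K] (⨂[K]^j V))).symm.toLinearMap ∘ₗ
            (through (letterBraid σ i) (⨂[K]^j V)).lTensor V ∘ₗ
              (TensorProduct.assoc K V (⨂[K]^i V) (V ⊗[K] (⨂[K]^j V))).toLinearMap ∘ₗ
                TensorProduct.map (headEquiv K V i).symm.toLinearMap
                  (headEquiv K V j).symm.toLinearMap
  termination_by i j => i + j

/-- The quantum quasi-shuffle product `⋈ : T(V) ⊗ T(V) → T(V)` built from `σ` and `μ`. -/
def qsh (σ : V ⊗[K] V →ₗ[K] V ⊗[K] V) (μ : V ⊗[K] V →ₗ[K] V) :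
    TensorAlgebra K V ⊗[K] TensorAlgebra K V →ₗ[K] TensorAlgebra K V :=
  TensorProduct.lift
      (DirectSum.toModule K ℕ _ fun i => LinearMap.flip
        (DirectSum.toModule K ℕ _ fun j => LinearMap.flip (TensorProduct.curry (qshPow σ μ i j)))) ∘ₗ
    TensorProduct.map TensorAlgebra.equivDirectSum.toLinearMap
      TensorAlgebra.equivDirectSum.toLinearMap

end Pow

/-- `(R, ∗, P)` is a (not necessarily unital) Rota-Baxter algebra of weight `c`: the bilinear
product `∗`, given as a linear map on `R ⊗ R`, is associative and `P` satisfies the Rota-Baxter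
identity. -/
structure IsRotaBaxter {R : Type*} [AddCommGroup R] [Module K R] (c : K)
    (mul : R ⊗[K] R →ₗ[K] R) (P : R →ₗ[K] R) : Prop where
  assoc : ∀ x y z : R, mul (mul (x ⊗ₜ y) ⊗ₜ z) = mul (x ⊗ₜ mul (y ⊗ₜ z))
  rota_baxter : ∀ x y : R, mul (P x ⊗ₜ P y) =
    P (mul (x ⊗ₜ P y)) + P (mul (P x ⊗ₜ y)) + c • P (mul (x ⊗ₜ y))

variable {A : Type*} [Ring A] [Algebra K A]

/-- `(A, m, 1, σ)` is a unital braided algebra, `m` being the product of the unital associative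
algebra `A`. Here `onFirstTwo σ A` is `σ_1` and `σ.lTensor A` is `σ_2` on `A ⊗ (A ⊗ A)`. -/
structure IsUnitalBraidedAlgebra (σ : A ⊗[K] A →ₗ[K] A ⊗[K] A) : Prop where
  bijective : Function.Bijective σ
  yang_baxter : onFirstTwo σ A ∘ₗ σ.lTensor A ∘ₗ onFirstTwo σ A =
    σ.lTensor A ∘ₗ onFirstTwo σ A ∘ₗ σ.lTensor A
  mul_left : (LinearMap.mul' K A).lTensor A ∘ₗ onFirstTwo σ A ∘ₗ σ.lTensor A =
    σ ∘ₗ (LinearMap.mul' K A).rTensor A ∘ₗ (TensorProduct.assoc K A A A).symm.toLinearMap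
  mul_right : (LinearMap.mul' K A).rTensor A ∘ₗ (TensorProduct.assoc K A A A).symm.toLinearMap ∘ₗ
      σ.lTensor A ∘ₗ onFirstTwo σ A =
    σ ∘ₗ (LinearMap.mul' K A).lTensor A
  apply_one : ∀ a : A, σ (a ⊗ₜ 1) = 1 ⊗ₜ a
  one_apply : ∀ a : A, σ (1 ⊗ₜ a) = a ⊗ₜ 1

/-- The product `◇_{σ,c} = (m ⊗ ⋈_{σ,c})(id ⊗ β ⊗ id)` on `A ⊗ T(A)`, where `⋈_{σ,c}` is the
quantum quasi-shuffle product built from `σ` and `c • m`. -/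
def diamond (σ : A ⊗[K] A →ₗ[K] A ⊗[K] A) (c : K) :
    (A ⊗[K] TensorAlgebra K A) ⊗[K] (A ⊗[K] TensorAlgebra K A) →ₗ[K] A ⊗[K] TensorAlgebra K A :=
  TensorProduct.map (LinearMap.mul' K A) (qsh σ (c • LinearMap.mul' K A)) ∘ₗ
    (TensorProduct.assoc K A A (TensorAlgebra K A ⊗[K] TensorAlgebra K A)).symm.toLinearMap ∘ₗ
      (through (tensorBraid σ) (TensorAlgebra K A)).lTensor A ∘ₗ
        (TensorProduct.assoc K A (TensorAlgebra K A) (A ⊗[K] TensorAlgebra K A)).toLinearMap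

/-- The operator `P (a ⊗ u) = 1 ⊗ (a u)` on `A ⊗ T(A)`. -/
def rbOp (K A : Type*) [Field K] [Ring A] [Algebra K A] :
    A ⊗[K] TensorAlgebra K A →ₗ[K] A ⊗[K] TensorAlgebra K A :=
  TensorProduct.mk K A (TensorAlgebra K A) 1 ∘ₗ consMap K A

end

end QuasiShuffle

/-!
The proof rests on one observation: every map from which the product `⋈` is built commutes with
moving a letter past its arguments. Call a map `X ⊗ V → V ⊗ X` a crossing of `X` with `V`, and a
linear map between two spaces with crossings a morphism if it intertwines them (`IsCrossHom`).
Morphisms are closed under sums, composition and tensor products. The Yang-Baxter equation says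
that `σ` is a morphism `V ⊗ V → V ⊗ V`, and the first compatibility of `σ` with the product `μ`
says that `μ` is a morphism `V ⊗ V → V`. By induction on the length, so are `β_{i1}`
(`isCrossHom_letterBraid`) and then, directly from its recursion, `⋈` (`isCrossHom_qsh`). The second
compatibility of `σ` and `μ` passes to `β` as well (`mulCompat_tensorBraid`).

The recursion is written as `x ⋈ y = x ≺ y + x ≻ y + x ∗ y` for words of positive length, where
the first letter of the result is that of `x`, that of `y`, or their product (`qshHead`, `qshPass`,
`qshFuse`). Expanding `(x ⋈ y) ⋈ z` and `x ⋈ (y ⋈ z)` gives seven terms on each side, which agree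
in pairs once associativity is known for words of smaller total length (`qshAssoc`); the pairings
are `qshHead_qshPass`, `qshPass_qsh`, `qshFuse_qshPass` and their multiples by a letter.

The product of `A ⊗ T(A)` is again an instance of `qshFuse`, so that its associativity is one of
these seven identities, and the Rota-Baxter identity is the recursion of `⋈` itself, since
`s ◇ P t` and `P s ◇ t` are the first two operations and `σ` fixes the letter `1`.

For the flip, `g (a ⊗ a₁ ⋯ aₙ) = f a * Q (f a₁ * Q (f a₂ * ⋯))` is the only candidate for the
universal map, and it is multiplicative because the Rota-Baxter identity in `B` is the recursion of
the quasi-shuffle product (`nestedMap_qsh`).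
-/

namespace QuasiShuffle

variable {K : Type*} [Field K] {V : Type*} [AddCommGroup V] [Module K V]

/-! ### Crossings with a fixed space, and the maps compatible with them -/

section Crossing

variable {X Y Z W : Type*} [AddCommGroup X] [Module K X] [AddCommGroup Y] [Module K Y]
  [AddCommGroup Z] [Module K Z] [AddCommGroup W] [Module K W]

@[simp]
theorem through_tmul (b : X ⊗[K] V →ₗ[K] V ⊗[K] X) (x : X) (v : V) (w : W) :
    through b W (x ⊗ₜ (v ⊗ₜ w)) = TensorProduct.assoc K V X W (b (x ⊗ₜ v) ⊗ₜ w) := rfl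

/-- Given crossings `X ⊗ V → V ⊗ X` and `Y ⊗ V → V ⊗ Y`, the crossing of `X ⊗ Y` with `V` which
moves the letter of `V` past `Y` and then past `X`. -/
noncomputable def crossTensor (bX : X ⊗[K] V →ₗ[K] V ⊗[K] X) (bY : Y ⊗[K] V →ₗ[K] V ⊗[K] Y) :
    (X ⊗[K] Y) ⊗[K] V →ₗ[K] V ⊗[K] (X ⊗[K] Y) :=
  through bX Y ∘ₗ bY.lTensor X ∘ₗ (TensorProduct.assoc K X Y V).toLinearMap

@[simp]
theorem crossTensor_tmul (bX : X ⊗[K] V →ₗ[K] V ⊗[K] X) (bY : Y ⊗[K] V →ₗ[K] V ⊗[K] Y)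
    (x : X) (y : Y) (v : V) :
    crossTensor bX bY ((x ⊗ₜ y) ⊗ₜ v) = through bX Y (x ⊗ₜ bY (y ⊗ₜ v)) := rfl

/-- The crossing `K ⊗ V → V ⊗ K` of the ground field: the flip. -/
noncomputable def crossUnit (K V : Type*) [Field K] [AddCommGroup V] [Module K V] :
    K ⊗[K] V →ₗ[K] V ⊗[K] K :=
  (TensorProduct.comm K K V).toLinearMap

/-- The linear map `f : X → Y` is compatible with the crossings of `X` and `Y` with `V`: a letter
of `V` may be moved past before or after `f` is applied. -/
def IsCrossHom (bX : X ⊗[K] V →ₗ[K] V ⊗[K] X) (bY : Y ⊗[K] V →ₗ[K] V ⊗[K] Y) (f : X →ₗ[K] Y) :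
    Prop :=
  bY ∘ₗ f.rTensor V = f.lTensor V ∘ₗ bX

variable {bX : X ⊗[K] V →ₗ[K] V ⊗[K] X} {bY : Y ⊗[K] V →ₗ[K] V ⊗[K] Y}
  {bZ : Z ⊗[K] V →ₗ[K] V ⊗[K] Z} {bW : W ⊗[K] V →ₗ[K] V ⊗[K] W}

theorem isCrossHom_iff {f : X →ₗ[K] Y} :
    IsCrossHom bX bY f ↔ ∀ x v, bY (f x ⊗ₜ v) = f.lTensor V (bX (x ⊗ₜ v)) := by
  constructor
  · intro h x v
    exact LinearMap.congr_fun h (x ⊗ₜ v)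
  · intro h
    exact TensorProduct.ext' h

namespace IsCrossHom

theorem apply {f : X →ₗ[K] Y} (hf : IsCrossHom bX bY f) (x : X) (v : V) :
    bY (f x ⊗ₜ v) = f.lTensor V (bX (x ⊗ₜ v)) :=
  isCrossHom_iff.1 hf x v

theorem id : IsCrossHom bX bX LinearMap.id := by
  rw [isCrossHom_iff]; intro x v; simp

theorem comp {g : Y →ₗ[K] Z} {f : X →ₗ[K] Y} (hg : IsCrossHom bY bZ g)
    (hf : IsCrossHom bX bY f) : IsCrossHom bX bZ (g ∘ₗ f) := by
  unfold IsCrossHom at *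
  rw [LinearMap.rTensor_comp, ← LinearMap.comp_assoc, hg, LinearMap.comp_assoc, hf,
    LinearMap.lTensor_comp, LinearMap.comp_assoc]

theorem add {f g : X →ₗ[K] Y} (hf : IsCrossHom bX bY f) (hg : IsCrossHom bX bY g) :
    IsCrossHom bX bY (f + g) := by
  rw [isCrossHom_iff] at *
  intro x v
  rw [LinearMap.add_apply, TensorProduct.add_tmul, map_add, hf, hg, LinearMap.lTensor_add,
    LinearMap.add_apply]

theorem smul (c : K) {f : X →ₗ[K] Y} (hf : IsCrossHom bX bY f) : IsCrossHom bX bY (c • f) := by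
  rw [isCrossHom_iff] at *
  intro x v
  rw [LinearMap.smul_apply, ← TensorProduct.smul_tmul', map_smul, hf, LinearMap.lTensor_smul,
    LinearMap.smul_apply]

theorem symm {e : X ≃ₗ[K] Y} (he : IsCrossHom bX bY e.toLinearMap) :
    IsCrossHom bY bX e.symm.toLinearMap := by
  rw [isCrossHom_iff] at *
  intro y v
  apply (TensorProduct.congr (LinearEquiv.refl K V) e).injective
  have h := he (e.symm y) v
  simp only [LinearEquiv.coe_coe, LinearEquiv.apply_symm_apply] at h
  have h1 : ∀ t, TensorProduct.congr (LinearEquiv.refl K V) e t = e.toLinearMap.lTensor V t :=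
    fun _ => rfl
  rw [h1, h1, LinearEquiv.coe_coe, ← h, ← LinearMap.comp_apply, ← LinearMap.lTensor_comp]
  simp

theorem map {f : X →ₗ[K] Y} {g : Z →ₗ[K] W} (hf : IsCrossHom bX bY f)
    (hg : IsCrossHom bZ bW g) :
    IsCrossHom (crossTensor bX bZ) (crossTensor bY bW) (TensorProduct.map f g) := by
  rw [isCrossHom_iff]
  intro t v
  induction t with
  | zero => simp
  | add s t hs ht => rw [map_add, TensorProduct.add_tmul, map_add, hs, ht, TensorProduct.add_tmul,
      map_add, map_add]
  | tmul x z =>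
    rw [TensorProduct.map_tmul, crossTensor_tmul, crossTensor_tmul, hg.apply]
    induction bZ (z ⊗ₜ v) with
    | zero => simp
    | add s t hs ht => simp only [map_add, TensorProduct.tmul_add, hs, ht]
    | tmul v' z' =>
      rw [LinearMap.lTensor_tmul, through_tmul, through_tmul, hf.apply]
      induction bX (x ⊗ₜ v') with
      | zero => simp
      | add s t hs ht => simp only [map_add, TensorProduct.add_tmul, hs, ht]
      | tmul v'' x' => simp

theorem lTensor (bX : X ⊗[K] V →ₗ[K] V ⊗[K] X) {g : Z →ₗ[K] W} (hg : IsCrossHom bZ bW g) :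
    IsCrossHom (crossTensor bX bZ) (crossTensor bX bW) (g.lTensor X) :=
  id.map hg

theorem rTensor (bZ : Z ⊗[K] V →ₗ[K] V ⊗[K] Z) {f : X →ₗ[K] Y} (hf : IsCrossHom bX bY f) :
    IsCrossHom (crossTensor bX bZ) (crossTensor bY bZ) (f.rTensor Z) :=
  hf.map id

theorem assoc (bX : X ⊗[K] V →ₗ[K] V ⊗[K] X) (bY : Y ⊗[K] V →ₗ[K] V ⊗[K] Y)
    (bZ : Z ⊗[K] V →ₗ[K] V ⊗[K] Z) :
    IsCrossHom (crossTensor (crossTensor bX bY) bZ) (crossTensor bX (crossTensor bY bZ))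
      (TensorProduct.assoc K X Y Z).toLinearMap := by
  rw [isCrossHom_iff]
  intro t v
  induction t with
  | zero => simp
  | add s t hs ht => rw [map_add, TensorProduct.add_tmul, map_add, hs, ht, TensorProduct.add_tmul,
      map_add, map_add]
  | tmul t z =>
    induction t with
    | zero => simp
    | add s t hs ht => simp only [map_add, TensorProduct.add_tmul, hs, ht]
    | tmul x y =>
      rw [LinearEquiv.coe_coe, TensorProduct.assoc_tmul, crossTensor_tmul, crossTensor_tmul,
        crossTensor_tmul]
      induction bZ (z ⊗ₜ v) with
      | zero => simp
      | add s t hs ht => simp only [map_add, TensorProduct.tmul_add, hs, ht]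
      | tmul v' z' =>
        rw [through_tmul, through_tmul, crossTensor_tmul]
        induction bY (y ⊗ₜ v') with
        | zero => simp
        | add s t hs ht => simp only [map_add, TensorProduct.tmul_add, TensorProduct.add_tmul, hs,
            ht]
        | tmul v'' y' =>
          rw [TensorProduct.assoc_tmul, through_tmul, through_tmul]
          induction bX (x ⊗ₜ v'') with
          | zero => simp
          | add s t hs ht => simp only [map_add, TensorProduct.add_tmul, hs, ht]
          | tmul v3 x' => simp

theorem lid (bX : X ⊗[K] V →ₗ[K] V ⊗[K] X) :
    IsCrossHom (crossTensor (crossUnit K V) bX) bX (TensorProduct.lid K X).toLinearMap := by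
  rw [isCrossHom_iff]
  intro t v
  induction t with
  | zero => simp
  | add s t hs ht => simp only [map_add, TensorProduct.add_tmul, hs, ht]
  | tmul r x =>
    rw [LinearEquiv.coe_coe, TensorProduct.lid_tmul, crossTensor_tmul, ← TensorProduct.smul_tmul',
      map_smul]
    induction bX (x ⊗ₜ v) with
    | zero => simp
    | add s t hs ht => simp only [map_add, TensorProduct.tmul_add, smul_add, hs, ht]
    | tmul v' x' => simp [crossUnit]

theorem rid (bX : X ⊗[K] V →ₗ[K] V ⊗[K] X) :
    IsCrossHom (crossTensor bX (crossUnit K V)) bX (TensorProduct.rid K X).toLinearMap := by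
  rw [isCrossHom_iff]
  intro t v
  induction t with
  | zero => simp
  | add s t hs ht => simp only [map_add, TensorProduct.add_tmul, hs, ht]
  | tmul x r =>
    rw [LinearEquiv.coe_coe, TensorProduct.rid_tmul, crossTensor_tmul, ← TensorProduct.smul_tmul',
      map_smul]
    simp only [crossUnit, LinearEquiv.coe_coe, TensorProduct.comm_tmul, through_tmul]
    induction bX (x ⊗ₜ v) with
    | zero => simp
    | add s t hs ht => simp only [map_add, TensorProduct.add_tmul, smul_add, hs, ht]
    | tmul v' x' => simp

/-- If the crossing of `X` with `V` is itself compatible with crossings, so is its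
extension by a spectator `W`. -/
theorem through {σ : V ⊗[K] V →ₗ[K] V ⊗[K] V}
    (hb : IsCrossHom (crossTensor bX σ) (crossTensor σ bX) bX)
    (bW : W ⊗[K] V →ₗ[K] V ⊗[K] W) :
    IsCrossHom (crossTensor bX (crossTensor σ bW)) (crossTensor σ (crossTensor bX bW))
      (QuasiShuffle.through bX W) :=
  (assoc σ bX bW).comp ((hb.rTensor bW).comp (assoc bX σ bW).symm)

end IsCrossHom

/-- The Yang-Baxter equation says that `σ` is compatible with the crossing `σ`. -/
theorem isCrossHom_of_yangBaxter {σ : V ⊗[K] V →ₗ[K] V ⊗[K] V}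
    (h : onFirstTwo σ V ∘ₗ σ.lTensor V ∘ₗ onFirstTwo σ V =
      σ.lTensor V ∘ₗ onFirstTwo σ V ∘ₗ σ.lTensor V) :
    IsCrossHom (crossTensor σ σ) (crossTensor σ σ) σ := by
  have h' : ∀ t : V ⊗[K] V, ∀ v, crossTensor σ σ (t ⊗ₜ v) =
      onFirstTwo σ V (σ.lTensor V (TensorProduct.assoc K V V V (t ⊗ₜ v))) := fun _ _ => rfl
  rw [isCrossHom_iff]
  intro t v
  induction t with
  | zero => simp
  | add s t hs ht => simp only [map_add, TensorProduct.add_tmul, hs, ht]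
  | tmul a b =>
    rw [h', h']
    exact LinearMap.congr_fun h (a ⊗ₜ (b ⊗ₜ v))

/-- The crossing `b` of `X` with `V` is compatible with the product `μ` of `V`: moving `μ (a, a')`
past `X` amounts to moving `a`, then `a'`, and multiplying. -/
def MulCompat (μ : V ⊗[K] V →ₗ[K] V) (b : X ⊗[K] V →ₗ[K] V ⊗[K] X) : Prop :=
  ∀ (x : X) (a a' : V), b (x ⊗ₜ μ (a ⊗ₜ a')) =
    μ.rTensor X ((TensorProduct.assoc K V V X).symm (b.lTensor V
      (TensorProduct.assoc K V X V (b (x ⊗ₜ a) ⊗ₜ a'))))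

/-- The crossing `b` of `X` with `V` fixes the letter `e`. -/
def FixesLetter (e : V) (b : X ⊗[K] V →ₗ[K] V ⊗[K] X) : Prop :=
  ∀ x : X, b (x ⊗ₜ e) = e ⊗ₜ x

theorem mulCompat_crossUnit (μ : V ⊗[K] V →ₗ[K] V) : MulCompat μ (crossUnit K V) := by
  intro x a a'; simp [crossUnit]

theorem MulCompat.tensor {μ : V ⊗[K] V →ₗ[K] V} (hX : MulCompat μ bX) (hY : MulCompat μ bY) :
    MulCompat μ (crossTensor bX bY) := by
  intro t a a'
  induction t with
  | zero => simp
  | add s t hs ht => simp only [map_add, TensorProduct.add_tmul, hs, ht]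
  | tmul x y =>
    rw [crossTensor_tmul, crossTensor_tmul, hY]
    induction bY (y ⊗ₜ a) with
    | zero => simp
    | add s t hs ht => simp only [map_add, TensorProduct.add_tmul, TensorProduct.tmul_add, hs, ht]
    | tmul b y' =>
      rw [TensorProduct.assoc_tmul, LinearMap.lTensor_tmul, through_tmul]
      have key : ∀ s : V ⊗[K] X, (crossTensor bX bY).lTensor V (TensorProduct.assoc K V (X ⊗[K] Y) V
          (TensorProduct.assoc K V X Y (s ⊗ₜ y') ⊗ₜ a')) =
          (QuasiShuffle.through bX Y).lTensor V (TensorProduct.assoc K V X (V ⊗[K] Y)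
            (s ⊗ₜ bY (y' ⊗ₜ a'))) := by
        intro s
        induction s with
        | zero => simp
        | add s t hs ht => simp only [map_add, TensorProduct.add_tmul, hs, ht]
        | tmul b' x' => simp
      rw [key]
      induction bY (y' ⊗ₜ a') with
      | zero => simp
      | add s t hs ht => simp only [map_add, TensorProduct.tmul_add, hs, ht]
      | tmul b' y'' =>
        rw [TensorProduct.assoc_symm_tmul, LinearMap.rTensor_tmul, through_tmul, hX]
        induction bX (x ⊗ₜ b) with
        | zero => simp
        | add s t hs ht => simp only [map_add, TensorProduct.add_tmul, hs, ht]
        | tmul b2 x2 =>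
          rw [TensorProduct.assoc_tmul, TensorProduct.assoc_tmul, LinearMap.lTensor_tmul,
            LinearMap.lTensor_tmul, through_tmul]
          induction bX (x2 ⊗ₜ b') with
          | zero => simp
          | add s t hs ht => simp only [map_add, TensorProduct.add_tmul, TensorProduct.tmul_add, hs,
              ht]
          | tmul b3 x3 => simp

/-- Compatibility with the product passes to the elements in the range of a morphism. -/
theorem MulCompat.apply_of_mem_range {μ : V ⊗[K] V →ₗ[K] V} {f : X →ₗ[K] Y} (hX : MulCompat μ bX)
    (hf : IsCrossHom bX bY f) (y : Y) (hy : y ∈ LinearMap.range f) (a a' : V) :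
    bY (y ⊗ₜ μ (a ⊗ₜ a')) =
    μ.rTensor Y ((TensorProduct.assoc K V V Y).symm (bY.lTensor V
      (TensorProduct.assoc K V Y V (bY (y ⊗ₜ a) ⊗ₜ a')))) := by
  obtain ⟨x, rfl⟩ := hy
  rw [hf.apply, hf.apply, hX]
  induction bX (x ⊗ₜ a) with
  | zero => simp
  | add s t hs ht => simp only [map_add, TensorProduct.add_tmul, hs, ht]
  | tmul b x' =>
    simp only [TensorProduct.assoc_tmul, LinearMap.lTensor_tmul, hf.apply]
    induction bX (x' ⊗ₜ a') with
    | zero => simp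
    | add s t hs ht => simp only [map_add, TensorProduct.tmul_add, hs, ht]
    | tmul b' x'' => simp

theorem FixesLetter.tensor {e : V} (hX : FixesLetter e bX) (hY : FixesLetter e bY) :
    FixesLetter e (crossTensor bX bY) := by
  intro t
  induction t with
  | zero => simp
  | add s t hs ht => simp only [map_add, TensorProduct.add_tmul, TensorProduct.tmul_add, hs, ht]
  | tmul x y => rw [crossTensor_tmul, hY, through_tmul, hX, TensorProduct.assoc_tmul]

end Crossing

end QuasiShuffle

namespace QuasiShuffle

variable {K : Type*} [Field K] {V : Type*} [AddCommGroup V] [Module K V]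

/-! ### The crossings of the tensor powers and of the tensor algebra -/

section Powers

theorem headEquiv_tprod (n : ℕ) (v : V) (a : Fin n → V) :
    headEquiv K V n (v ⊗ₜ PiTensorProduct.tprod K a) =
      PiTensorProduct.tprod K (Fin.cons v a : Fin (n + 1) → V) := by
  have h1 : (oneEquiv K V).symm v = PiTensorProduct.tprod K (fun _ : Fin 1 => v) :=
    PiTensorProduct.subsingletonEquiv_symm_apply' (R := K) (0 : Fin 1) v
  rw [headEquiv, LinearEquiv.trans_apply, TensorProduct.congr_tmul, h1, LinearEquiv.refl_apply,
    LinearEquiv.trans_apply, ← TensorPower.gMul_def, TensorPower.tprod_mul_tprod,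
    TensorPower.cast_tprod, Fin.append_left_eq_cons]
  rfl

/-- Appending a letter at the end of a word, `V^{⊗n} ⊗ V → V^{⊗(n+1)}`. -/
noncomputable def snocMap (K V : Type*) [Field K] [AddCommGroup V] [Module K V] (n : ℕ) :
    (⨂[K]^n V) ⊗[K] V →ₗ[K] (⨂[K]^(n + 1) V) :=
  (TensorPower.mulEquiv (n := n) (m := 1)).toLinearMap ∘ₗ
    (oneEquiv K V).symm.toLinearMap.lTensor _

theorem snocMap_tprod (n : ℕ) (v : V) (a : Fin n → V) :
    snocMap K V n (PiTensorProduct.tprod K a ⊗ₜ v) =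
      PiTensorProduct.tprod K (Fin.snoc a v : Fin (n + 1) → V) := by
  have h1 : (oneEquiv K V).symm v = PiTensorProduct.tprod K (fun _ : Fin 1 => v) :=
    PiTensorProduct.subsingletonEquiv_symm_apply' (R := K) (0 : Fin 1) v
  have h2 : snocMap K V n (PiTensorProduct.tprod K a ⊗ₜ v) =
    TensorPower.mulEquiv (PiTensorProduct.tprod K a ⊗ₜ (oneEquiv K V).symm v) := rfl
  rw [h2, h1, ← TensorPower.gMul_def, TensorPower.tprod_mul_tprod, Fin.append_right_eq_snoc]

theorem snocMap_headEquiv (n : ℕ) (v : V) (x : ⨂[K]^n V) (w : V) :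
    snocMap K V (n + 1) (headEquiv K V n (v ⊗ₜ x) ⊗ₜ w) =
      headEquiv K V (n + 1) (v ⊗ₜ snocMap K V n (x ⊗ₜ w)) := by
  induction x using PiTensorProduct.induction_on with
  | smul_tprod r a =>
    simp only [TensorProduct.tmul_smul, map_smul, ← TensorProduct.smul_tmul']
    rw [headEquiv_tprod, snocMap_tprod, snocMap_tprod, headEquiv_tprod, Fin.cons_snoc_eq_snoc_cons]
  | add x y hx hy => simp only [TensorProduct.tmul_add, map_add, TensorProduct.add_tmul, hx, hy]

variable (σ : V ⊗[K] V →ₗ[K] V ⊗[K] V)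

theorem letterBraid_tmul (i : ℕ) (x : ⨂[K]^i V) (v : V) :
    letterBraid σ i (x ⊗ₜ v) =
      (headEquiv K V i).symm (wordOp σ (i + 1) (List.range' 0 i) (snocMap K V i (x ⊗ₜ v))) := by
  have h : blockWord i 1 = List.range' 0 i := by simp [blockWord, List.range_succ]
  rw [← h]
  rfl

theorem wordOp_succ (n : ℕ) (w : List ℕ) (v : V) (x : ⨂[K]^n V) :
    wordOp σ (n + 1) (w.map Nat.succ) (headEquiv K V n (v ⊗ₜ x)) =
      headEquiv K V n (v ⊗ₜ wordOp σ n w x) := by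
  induction w with
  | nil => rfl
  | cons k w ih =>
    have h1 : wordOp σ (n + 1) ((k :: w).map Nat.succ) (headEquiv K V n (v ⊗ₜ x)) =
      sigmaAt σ (k + 1) (n + 1) (wordOp σ (n + 1) (w.map Nat.succ) (headEquiv K V n (v ⊗ₜ x))) := by
      simp only [wordOp, List.map_cons, List.prod_cons]; rfl
    have h2 : wordOp σ n (k :: w) x = sigmaAt σ k n (wordOp σ n w x) := by
      simp only [wordOp, List.map_cons, List.prod_cons]; rfl
    rw [h1, h2, ih, sigmaAt]
    simp

/-- Moving a letter past a word moves it past the tail and then past the head. -/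
theorem letterBraid_headEquiv (i : ℕ) (a : V) (x : ⨂[K]^i V) (v : V) :
    letterBraid σ (i + 1) (headEquiv K V i (a ⊗ₜ x) ⊗ₜ v) =
      (headEquiv K V i).toLinearMap.lTensor V (through σ _ (a ⊗ₜ letterBraid σ i (x ⊗ₜ v))) := by
  have hr : List.range' 0 (i + 1) = 0 :: (List.range' 0 i).map Nat.succ := by
    have h : (Nat.succ : ℕ → ℕ) = (1 + ·) := funext fun n => Nat.add_comm n 1
    rw [List.range'_succ, h, List.map_add_range']
  have hw : ∀ y, wordOp σ (i + 2) (List.range' 0 (i + 1)) y =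
      sigmaAt σ 0 (i + 2) (wordOp σ (i + 2) ((List.range' 0 i).map Nat.succ) y) := by
    intro y
    rw [hr]; simp only [wordOp, List.map_cons, List.prod_cons]; rfl
  rw [letterBraid_tmul, snocMap_headEquiv, hw, wordOp_succ, letterBraid_tmul, sigmaAt]
  generalize wordOp σ (i + 1) (List.range' 0 i) (snocMap K V i (x ⊗ₜ v)) = y
  simp
  rfl

theorem isCrossHom_headEquiv (i : ℕ) :
    IsCrossHom (crossTensor σ (letterBraid σ i)) (letterBraid σ (i + 1))
      (headEquiv K V i).toLinearMap := by
  rw [isCrossHom_iff]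
  intro t v
  induction t with
  | zero => simp
  | add s t hs ht => rw [map_add, TensorProduct.add_tmul, map_add, hs, ht, TensorProduct.add_tmul,
      map_add, map_add]
  | tmul a x => rw [LinearEquiv.coe_coe, letterBraid_headEquiv, crossTensor_tmul]

theorem letterBraid_zero (r : K) (v : V) :
    letterBraid σ 0 (TensorPower.algebraMap₀ r ⊗ₜ v) = v ⊗ₜ TensorPower.algebraMap₀ r := by
  rw [letterBraid_tmul, LinearEquiv.symm_apply_eq, TensorPower.algebraMap₀_eq_smul_one]
  simp only [wordOp, List.range'_zero, List.map_nil, List.prod_nil, Module.End.one_apply]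
  simp only [TensorProduct.tmul_smul, map_smul, ← TensorProduct.smul_tmul', TensorPower.gOne_def]
  rw [snocMap_tprod, headEquiv_tprod]
  congr 2
  ext i
  fin_cases i
  rfl

theorem isCrossHom_algebraMap₀ :
    IsCrossHom (crossUnit K V) (letterBraid σ 0)
      (TensorPower.algebraMap₀ (R := K) (M := V)).toLinearMap := by
  rw [isCrossHom_iff]
  intro r v
  rw [LinearEquiv.coe_coe, letterBraid_zero]
  simp [crossUnit]

variable {σ}

/-- For a solution of the Yang-Baxter equation, moving a letter past a word is compatible with
crossings. -/
theorem isCrossHom_letterBraid (hσ : IsCrossHom (crossTensor σ σ) (crossTensor σ σ) σ) (i : ℕ) :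
    IsCrossHom (crossTensor (letterBraid σ i) σ) (crossTensor σ (letterBraid σ i))
      (letterBraid σ i) := by
  induction i with
  | zero =>
    have h : letterBraid σ 0 =
        ((TensorPower.algebraMap₀ (R := K) (M := V)).toLinearMap.lTensor V ∘ₗ
          (TensorProduct.rid K V).symm.toLinearMap) ∘ₗ ((TensorProduct.lid K V).toLinearMap ∘ₗ
          (TensorPower.algebraMap₀ (R := K) (M := V)).symm.toLinearMap.rTensor V) := by
      refine TensorProduct.ext' fun x v => ?_
      obtain ⟨r, rfl⟩ := (TensorPower.algebraMap₀ (R := K) (M := V)).surjective x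
      have hr : (TensorPower.algebraMap₀ r : ⨂[K]^0 V) = r • TensorPower.algebraMap₀ 1 := by
        rw [← map_smul, smul_eq_mul, mul_one]
      rw [letterBraid_zero]
      rw [hr]
      simp
    have h1 := isCrossHom_algebraMap₀ σ
    have h2 := ((h1.lTensor σ).comp (IsCrossHom.rid σ).symm).comp
      ((IsCrossHom.lid σ).comp (h1.symm.rTensor σ))
    rwa [← h] at h2
  | succ i ih =>
    have h : letterBraid σ (i + 1) =
        (headEquiv K V i).toLinearMap.lTensor V ∘ₗ (through σ _ ∘ₗ
          ((letterBraid σ i).lTensor V ∘ₗ ((TensorProduct.assoc K V _ V).toLinearMap ∘ₗ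
            (headEquiv K V i).symm.toLinearMap.rTensor V))) := by
      refine TensorProduct.ext' fun x v => ?_
      obtain ⟨t, rfl⟩ := (headEquiv K V i).surjective x
      induction t with
      | zero => simp
      | add s t hs ht => rw [map_add, TensorProduct.add_tmul, map_add, hs, ht, map_add]
      | tmul a x => rw [letterBraid_headEquiv]; simp
    have h1 := isCrossHom_headEquiv σ i
    have h2 := (h1.lTensor σ).comp ((hσ.through (letterBraid σ i)).comp
      ((ih.lTensor σ).comp ((IsCrossHom.assoc σ (letterBraid σ i) σ).comp (h1.symm.rTensor σ))))
    rwa [← h] at h2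

theorem mulCompat_letterBraid {μ : V ⊗[K] V →ₗ[K] V} (hμ : MulCompat μ σ) (i : ℕ) :
    MulCompat μ (letterBraid σ i) := by
  induction i with
  | zero =>
    intro y a a'
    exact (mulCompat_crossUnit μ).apply_of_mem_range (isCrossHom_algebraMap₀ σ) y
      ((TensorPower.algebraMap₀ (R := K) (M := V)).surjective y) a a'
  | succ i ih =>
    intro y a a'
    exact (hμ.tensor ih).apply_of_mem_range (isCrossHom_headEquiv σ i) y
      ((headEquiv K V i).surjective y) a a'

theorem fixesLetter_letterBraid {e : V} (he : FixesLetter e σ) (i : ℕ) :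
    FixesLetter e (letterBraid σ i) := by
  induction i with
  | zero =>
    intro y
    obtain ⟨r, rfl⟩ := (TensorPower.algebraMap₀ (R := K) (M := V)).surjective y
    exact letterBraid_zero σ r e
  | succ i ih =>
    intro y
    obtain ⟨t, rfl⟩ := (headEquiv K V i).surjective y
    have h := (isCrossHom_headEquiv σ i).apply t e
    rw [he.tensor ih] at h
    exact h

/-! ### Passage to the tensor algebra -/

theorem toTensorAlgebra_headEquiv (i : ℕ) (a : V) (x : ⨂[K]^i V) :
    TensorPower.toTensorAlgebra (headEquiv K V i (a ⊗ₜ x)) =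
      TensorAlgebra.ι K a * TensorPower.toTensorAlgebra x := by
  induction x using PiTensorProduct.induction_on with
  | smul_tprod r a =>
    simp only [TensorProduct.tmul_smul, map_smul, mul_smul_comm]
    rw [headEquiv_tprod]
    simp
  | add x y hx hy => simp only [TensorProduct.tmul_add, map_add, mul_add, hx, hy]

theorem toTensorAlgebra_algebraMap₀ (r : K) :
    TensorPower.toTensorAlgebra (TensorPower.algebraMap₀ r : ⨂[K]^0 V) = r • 1 := by
  rw [TensorPower.algebraMap₀_eq_smul_one, map_smul, TensorPower.toTensorAlgebra_gOne]

theorem equivDirectSum_toTensorAlgebra (i : ℕ) (x : ⨂[K]^i V) :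
    TensorAlgebra.equivDirectSum (TensorPower.toTensorAlgebra x) =
      DirectSum.lof K ℕ (fun n => ⨂[K]^n V) i x := by
  induction x using PiTensorProduct.induction_on with
  | smul_tprod r a =>
    rw [map_smul, map_smul, map_smul, TensorPower.toTensorAlgebra_tprod,
      TensorAlgebra.equivDirectSum_apply, TensorAlgebra.toDirectSum_tensorPower_tprod]
    rfl
  | add x y hx hy => simp only [map_add, hx, hy]

/-- An additive statement about the tensor algebra may be checked on homogeneous elements. -/
theorem tensorAlgebra_induction {P : TensorAlgebra K V → Prop}
    (add : ∀ s t, P s → P t → P (s + t))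
    (homogeneous : ∀ (i : ℕ) (x : ⨂[K]^i V), P (TensorPower.toTensorAlgebra x))
    (t : TensorAlgebra K V) : P t := by
  obtain ⟨d, rfl⟩ := (TensorAlgebra.equivDirectSum (R := K) (M := V)).symm.surjective t
  induction d using DirectSum.induction_on with
  | zero => simpa using homogeneous 0 0
  | of i x =>
    have h : TensorAlgebra.equivDirectSum.symm (DirectSum.of (fun n => ⨂[K]^n V) i x) =
        TensorPower.toTensorAlgebra x := by
      rw [AlgEquiv.symm_apply_eq, equivDirectSum_toTensorAlgebra]
      rfl
    rw [h]
    exact homogeneous i x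
  | add s t hs ht => rw [map_add]; exact add _ _ hs ht

/-- A linear statement about the tensor algebra may be checked by adding letters in front. -/
theorem tensorAlgebra_cons_induction {P : TensorAlgebra K V → Prop}
    (add : ∀ s t, P s → P t → P (s + t)) (smul : ∀ (r : K) t, P t → P (r • t)) (one : P 1)
    (cons : ∀ a t, P t → P (TensorAlgebra.ι K a * t)) (t : TensorAlgebra K V) : P t := by
  suffices h : ∀ s, P s → P (t * s) by simpa using h 1 one
  induction t using TensorAlgebra.induction with
  | algebraMap r => intro s hs; rw [← Algebra.smul_def]; exact smul r s hs
  | ι a => exact cons a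
  | mul x y hx hy => intro s hs; rw [mul_assoc]; exact hx _ (hy s hs)
  | add x y hx hy => intro s hs; rw [add_mul]; exact add _ _ (hx s hs) (hy s hs)

@[simp]
theorem consMap_tmul (a : V) (t : TensorAlgebra K V) :
    consMap K V (a ⊗ₜ t) = TensorAlgebra.ι K a * t := rfl

variable (σ)

theorem isCrossHom_toTensorAlgebra (i : ℕ) :
    IsCrossHom (letterBraid σ i) (tensorBraid σ)
      (TensorPower.toTensorAlgebra (R := K) (M := V) (n := i)) := by
  rw [isCrossHom_iff]
  intro x v
  have h : tensorBraid σ (TensorPower.toTensorAlgebra x ⊗ₜ v) = (DirectSum.toModule K ℕ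
    (V →ₗ[K] V ⊗[K] TensorAlgebra K V) fun i => TensorProduct.curry
          ((TensorPower.toTensorAlgebra (n := i)).lTensor V ∘ₗ letterBraid σ i))
      (TensorAlgebra.equivDirectSum (TensorPower.toTensorAlgebra x)) v := rfl
  rw [h, equivDirectSum_toTensorAlgebra, DirectSum.toModule_lof]
  rfl

theorem tensorBraid_one (v : V) : tensorBraid σ (1 ⊗ₜ v) = v ⊗ₜ 1 := by
  have h := (isCrossHom_toTensorAlgebra σ 0).apply (TensorPower.algebraMap₀ 1) v
  rw [letterBraid_zero, toTensorAlgebra_algebraMap₀, LinearMap.lTensor_tmul,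
    toTensorAlgebra_algebraMap₀] at h
  simpa using h

theorem isCrossHom_consMap :
    IsCrossHom (crossTensor σ (tensorBraid σ)) (tensorBraid σ) (consMap K V) := by
  rw [isCrossHom_iff]
  intro t v
  induction t with
  | zero => simp
  | add s t hs ht => simp only [map_add, TensorProduct.add_tmul, hs, ht]
  | tmul a t =>
    induction t using tensorAlgebra_induction with
    | add s t hs ht => simp only [map_add, TensorProduct.tmul_add, TensorProduct.add_tmul, hs, ht]
    | homogeneous i x =>
      have h1 := (isCrossHom_toTensorAlgebra σ (i + 1)).apply (headEquiv K V i (a ⊗ₜ x)) v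
      have h2 := ((isCrossHom_toTensorAlgebra σ i).lTensor σ).apply (a ⊗ₜ x) v
      rw [toTensorAlgebra_headEquiv, letterBraid_headEquiv] at h1
      rw [LinearMap.lTensor_tmul, crossTensor_tmul σ (letterBraid σ i)] at h2
      rw [h2, consMap_tmul, h1]
      generalize through σ _ (a ⊗ₜ letterBraid σ i (x ⊗ₜ v)) = s
      rw [← LinearMap.comp_apply, ← LinearMap.comp_apply, ← LinearMap.lTensor_comp,
        ← LinearMap.lTensor_comp]
      congr 2
      refine TensorProduct.ext' fun b y => ?_
      simp [toTensorAlgebra_headEquiv]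

theorem tensorBraid_cons (a : V) (t : TensorAlgebra K V) (v : V) :
    tensorBraid σ ((TensorAlgebra.ι K a * t) ⊗ₜ v) =
      (consMap K V).lTensor V (through σ _ (a ⊗ₜ tensorBraid σ (t ⊗ₜ v))) :=
  (isCrossHom_consMap σ).apply (a ⊗ₜ t) v

variable {σ}

theorem mulCompat_tensorBraid {μ : V ⊗[K] V →ₗ[K] V} (hμ : MulCompat μ σ) :
    MulCompat μ (tensorBraid σ) := by
  intro t a a'
  induction t using tensorAlgebra_induction with
  | add s t hs ht => simp only [map_add, TensorProduct.add_tmul, hs, ht]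
  | homogeneous i x =>
    exact (mulCompat_letterBraid hμ i).apply_of_mem_range (isCrossHom_toTensorAlgebra σ i) _
      ⟨x, rfl⟩ a a'

theorem fixesLetter_tensorBraid {e : V} (he : FixesLetter e σ) :
    FixesLetter e (tensorBraid σ) := by
  intro t
  induction t using tensorAlgebra_induction with
  | add s t hs ht => simp only [map_add, TensorProduct.add_tmul, TensorProduct.tmul_add, hs, ht]
  | homogeneous i x =>
    rw [(isCrossHom_toTensorAlgebra σ i).apply, fixesLetter_letterBraid he]
    rfl

end Powers
end QuasiShuffle

namespace QuasiShuffle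

variable {K : Type*} [Field K] {V : Type*} [AddCommGroup V] [Module K V]

/-! ### The quantum quasi-shuffle product -/

section Product

variable (σ : V ⊗[K] V →ₗ[K] V ⊗[K] V) (μ : V ⊗[K] V →ₗ[K] V)

theorem qsh_toTensorAlgebra (i j : ℕ) (x : ⨂[K]^i V) (y : ⨂[K]^j V) :
    qsh σ μ (TensorPower.toTensorAlgebra x ⊗ₜ TensorPower.toTensorAlgebra y) =
      qshPow σ μ i j (x ⊗ₜ y) := by
  have h : qsh σ μ (TensorPower.toTensorAlgebra x ⊗ₜ TensorPower.toTensorAlgebra y) =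
    (DirectSum.toModule K ℕ _ fun i => LinearMap.flip
      (DirectSum.toModule K ℕ _ fun j => LinearMap.flip (TensorProduct.curry (qshPow σ μ i j))))
      (TensorAlgebra.equivDirectSum (TensorPower.toTensorAlgebra x))
      (TensorAlgebra.equivDirectSum (TensorPower.toTensorAlgebra y)) := rfl
  rw [h, equivDirectSum_toTensorAlgebra, equivDirectSum_toTensorAlgebra, DirectSum.toModule_lof,
    LinearMap.flip_apply, DirectSum.toModule_lof]
  rfl

theorem qshPow_eq (i j : ℕ) :
    qshPow σ μ i j = qsh σ μ ∘ₗ TensorProduct.map (TensorPower.toTensorAlgebra (n := i))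
      (TensorPower.toTensorAlgebra (n := j)) :=
  TensorProduct.ext' fun x y => (qsh_toTensorAlgebra σ μ i j x y).symm

theorem qsh_one_left (y : TensorAlgebra K V) : qsh σ μ (1 ⊗ₜ y) = y := by
  induction y using tensorAlgebra_induction with
  | add s t hs ht => rw [TensorProduct.tmul_add, map_add, hs, ht]
  | homogeneous j y =>
    have h := qsh_toTensorAlgebra σ μ 0 j (TensorPower.algebraMap₀ 1) y
    rw [toTensorAlgebra_algebraMap₀, one_smul] at h
    rw [h, qshPow]
    simp

theorem qsh_one_right (x : TensorAlgebra K V) : qsh σ μ (x ⊗ₜ 1) = x := by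
  induction x using tensorAlgebra_induction with
  | add s t hs ht => rw [TensorProduct.add_tmul, map_add, hs, ht]
  | homogeneous i x =>
    have h := qsh_toTensorAlgebra σ μ i 0 x (TensorPower.algebraMap₀ 1)
    rw [toTensorAlgebra_algebraMap₀, one_smul] at h
    rw [h]
    cases i with
    | zero =>
      obtain ⟨r, rfl⟩ := (TensorPower.algebraMap₀ (R := K) (M := V)).surjective x
      rw [qshPow]
      simp [toTensorAlgebra_algebraMap₀]
    | succ i =>
      rw [qshPow]
      simp

variable {σ μ}

theorem isCrossHom_qshPow (hσ : IsCrossHom (crossTensor σ σ) (crossTensor σ σ) σ)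
    (hμ : IsCrossHom (crossTensor σ σ) σ μ) (n : ℕ) : ∀ i j, i + j = n →
    IsCrossHom (crossTensor (letterBraid σ i) (letterBraid σ j)) (tensorBraid σ)
      (qshPow σ μ i j) := by
  induction n using Nat.strong_induction_on with
  | _ n ih =>
    intro i j hij
    have hu := (isCrossHom_algebraMap₀ σ).symm
    match i, j with
    | 0, j =>
      rw [qshPow]
      exact (isCrossHom_toTensorAlgebra σ j).comp
        ((IsCrossHom.lid (letterBraid σ j)).comp (hu.rTensor (letterBraid σ j)))
    | i + 1, 0 =>
      rw [qshPow]
      exact (isCrossHom_toTensorAlgebra σ (i + 1)).comp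
        ((IsCrossHom.rid (letterBraid σ (i + 1))).comp (hu.lTensor (letterBraid σ (i + 1))))
    | i + 1, j + 1 =>
      rw [qshPow]
      have hc := isCrossHom_consMap σ
      have h1 := ih _ (by omega) i (j + 1) rfl
      have h2 := ih _ (by omega) (i + 1) j rfl
      have h3 := ih _ (by omega) i j rfl
      have hi := (isCrossHom_headEquiv σ i).symm
      have hj := (isCrossHom_headEquiv σ j).symm
      refine ((hc.comp ((h1.lTensor σ).comp ((IsCrossHom.assoc _ _ _).comp
        (hi.rTensor _)))).add (hc.comp ((h2.lTensor σ).comp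
        (((isCrossHom_letterBraid hσ (i + 1)).through _).comp (hj.lTensor _))))).add
        (hc.comp ((hμ.map h3).comp ((IsCrossHom.assoc _ _ _).symm.comp
        ((((isCrossHom_letterBraid hσ i).through _).lTensor σ).comp
        ((IsCrossHom.assoc _ _ _).comp (hi.map hj))))))

/-- Moving a letter past a quantum quasi-shuffle product amounts to moving it past both factors. -/
theorem isCrossHom_qsh (hσ : IsCrossHom (crossTensor σ σ) (crossTensor σ σ) σ)
    (hμ : IsCrossHom (crossTensor σ σ) σ μ) :
    IsCrossHom (crossTensor (tensorBraid σ) (tensorBraid σ)) (tensorBraid σ) (qsh σ μ) := by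
  rw [isCrossHom_iff]
  intro t v
  induction t with
  | zero => simp
  | add s t hs ht => simp only [map_add, TensorProduct.add_tmul, hs, ht]
  | tmul x y =>
    induction x using tensorAlgebra_induction with
    | add s t hs ht => simp only [map_add, TensorProduct.add_tmul, hs, ht]
    | homogeneous i x =>
      induction y using tensorAlgebra_induction with
      | add s t hs ht => simp only [map_add, TensorProduct.add_tmul, TensorProduct.tmul_add, hs, ht]
      | homogeneous j y =>
        have h1 := (isCrossHom_qshPow hσ hμ _ i j rfl).apply (x ⊗ₜ y) v
        have h2 := ((isCrossHom_toTensorAlgebra σ i).map (isCrossHom_toTensorAlgebra σ j)).apply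
          (x ⊗ₜ y) v
        rw [TensorProduct.map_tmul] at h2
        rw [h2, qsh_toTensorAlgebra, h1, qshPow_eq, LinearMap.lTensor_comp, LinearMap.comp_apply]

variable (σ μ)

/-- The operation `(a x, y) ↦ a (x ⋈ y)`: the first letter is that of the left factor. It takes
values in `V ⊗ T(V)`, as `qshPass` and `qshFuse` do; `consMap` turns them into elements of
`T(V)`. -/
noncomputable def qshHead :
    (V ⊗[K] TensorAlgebra K V) ⊗[K] TensorAlgebra K V →ₗ[K] V ⊗[K] TensorAlgebra K V :=
  (qsh σ μ).lTensor V ∘ₗ (TensorProduct.assoc K V _ _).toLinearMap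

/-- The operation `(x, b y) ↦ (id ⊗ ⋈)(β (x ⊗ b) ⊗ y)`: the first letter is that of the right
factor, which has been moved past the left one. -/
noncomputable def qshPass :
    TensorAlgebra K V ⊗[K] (V ⊗[K] TensorAlgebra K V) →ₗ[K] V ⊗[K] TensorAlgebra K V :=
  (qsh σ μ).lTensor V ∘ₗ through (tensorBraid σ) (TensorAlgebra K V)

/-- The operation `(a x, b y) ↦ (ν ⊗ ⋈)(a ⊗ β (x ⊗ b) ⊗ y)`: the first letter is obtained by
multiplying those of both factors. The product `ν` used for this is a parameter of its own:
for `ν = μ` one obtains the third term of the recursion for `⋈`, and for the product of an algebra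
`A`, with `μ` a multiple of it, the product of `A ⊗ T(A)`. -/
noncomputable def qshFuse (ν : V ⊗[K] V →ₗ[K] V) :
    (V ⊗[K] TensorAlgebra K V) ⊗[K] (V ⊗[K] TensorAlgebra K V) →ₗ[K] V ⊗[K] TensorAlgebra K V :=
  ν.rTensor (TensorAlgebra K V) ∘ₗ (TensorProduct.assoc K V V _).symm.toLinearMap ∘ₗ
    (qshPass σ μ).lTensor V ∘ₗ (TensorProduct.assoc K V _ _).toLinearMap

/-- Multiplication by `a` of the first letter of an element of `V ⊗ T(V)`. -/
noncomputable def mulLetter (ν : V ⊗[K] V →ₗ[K] V) (a : V) :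
    V ⊗[K] TensorAlgebra K V →ₗ[K] V ⊗[K] TensorAlgebra K V :=
  (TensorProduct.curry ν a).rTensor _

@[simp]
theorem mulLetter_tmul (ν : V ⊗[K] V →ₗ[K] V) (a b : V) (t : TensorAlgebra K V) :
    mulLetter ν a (b ⊗ₜ t) = ν (a ⊗ₜ b) ⊗ₜ t := rfl

@[simp]
theorem qshHead_tmul (a : V) (x y : TensorAlgebra K V) :
    qshHead σ μ ((a ⊗ₜ x) ⊗ₜ y) = a ⊗ₜ qsh σ μ (x ⊗ₜ y) := rfl

theorem qshPass_tmul (x : TensorAlgebra K V) (b : V) (y : TensorAlgebra K V) :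
    qshPass σ μ (x ⊗ₜ (b ⊗ₜ y)) = qshHead σ μ (tensorBraid σ (x ⊗ₜ b) ⊗ₜ y) := rfl

theorem qshFuse_tmul (ν : V ⊗[K] V →ₗ[K] V) (a : V) (x : TensorAlgebra K V)
    (s : V ⊗[K] TensorAlgebra K V) :
    qshFuse σ μ ν ((a ⊗ₜ x) ⊗ₜ s) = mulLetter ν a (qshPass σ μ (x ⊗ₜ s)) := by
  have h : qshFuse σ μ ν ((a ⊗ₜ x) ⊗ₜ s) = ν.rTensor (TensorAlgebra K V)
    ((TensorProduct.assoc K V V _).symm (a ⊗ₜ qshPass σ μ (x ⊗ₜ s))) := rfl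
  rw [h]
  induction qshPass σ μ (x ⊗ₜ s) with
  | zero => simp
  | add s t hs ht => simp only [map_add, TensorProduct.tmul_add, hs, ht]
  | tmul b t => simp

theorem qsh_cons_cons_tmul (a : V) (x : TensorAlgebra K V) (b : V) (y : TensorAlgebra K V) :
    qsh σ μ ((TensorAlgebra.ι K a * x) ⊗ₜ (TensorAlgebra.ι K b * y)) =
      consMap K V (qshHead σ μ ((a ⊗ₜ x) ⊗ₜ (TensorAlgebra.ι K b * y)) +
        qshPass σ μ ((TensorAlgebra.ι K a * x) ⊗ₜ (b ⊗ₜ y)) +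
        qshFuse σ μ μ ((a ⊗ₜ x) ⊗ₜ (b ⊗ₜ y))) := by
  induction x using tensorAlgebra_induction with
  | add s t hs ht =>
    simp only [mul_add, map_add, TensorProduct.add_tmul, TensorProduct.tmul_add] at hs ht ⊢
    rw [hs, ht]
    abel
  | homogeneous i x =>
    induction y using tensorAlgebra_induction with
    | add s t hs ht =>
      simp only [mul_add, map_add, TensorProduct.tmul_add] at hs ht ⊢
      rw [hs, ht]
      abel
    | homogeneous j y =>
      have pass : ∀ (i : ℕ) (x : ⨂[K]^i V), (qshPow σ μ i j).lTensor V
          (through (letterBraid σ i) (⨂[K]^j V) (x ⊗ₜ (b ⊗ₜ y))) =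
          qshPass σ μ (TensorPower.toTensorAlgebra x ⊗ₜ (b ⊗ₜ TensorPower.toTensorAlgebra y)) := by
        intro i x
        rw [through_tmul, qshPass_tmul, (isCrossHom_toTensorAlgebra σ i).apply]
        induction letterBraid σ i (x ⊗ₜ b) with
        | zero => simp
        | add s t hs ht => simp only [map_add, TensorProduct.add_tmul, hs, ht]
        | tmul b' x' => simp [qsh_toTensorAlgebra]
      have fuse : TensorProduct.map μ (qshPow σ μ i j)
          ((TensorProduct.assoc K V V ((⨂[K]^i V) ⊗[K] (⨂[K]^j V))).symm
            (a ⊗ₜ through (letterBraid σ i) (⨂[K]^j V) (x ⊗ₜ (b ⊗ₜ y)))) =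
          qshFuse σ μ μ ((a ⊗ₜ TensorPower.toTensorAlgebra x) ⊗ₜ
            (b ⊗ₜ TensorPower.toTensorAlgebra y)) := by
        rw [qshFuse_tmul, ← pass]
        induction through (letterBraid σ i) (⨂[K]^j V) (x ⊗ₜ (b ⊗ₜ y)) with
        | zero => simp
        | add s t hs ht => simp only [map_add, TensorProduct.tmul_add, hs, ht]
        | tmul b t => simp
      rw [← toTensorAlgebra_headEquiv, ← toTensorAlgebra_headEquiv, qsh_toTensorAlgebra, qshPow,
        map_add, map_add, ← fuse, ← pass, qshHead_tmul, qsh_toTensorAlgebra]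
      simp

/-- The recursion of the quantum quasi-shuffle product, in bilinear form. -/
theorem qsh_consMap_consMap (s t : V ⊗[K] TensorAlgebra K V) :
    qsh σ μ (consMap K V s ⊗ₜ consMap K V t) =
      consMap K V (qshHead σ μ (s ⊗ₜ consMap K V t) + qshPass σ μ (consMap K V s ⊗ₜ t) +
        qshFuse σ μ μ (s ⊗ₜ t)) := by
  induction s with
  | zero => simp
  | add s s' hs hs' =>
    simp only [map_add, TensorProduct.add_tmul] at hs hs' ⊢
    rw [hs, hs']
    abel
  | tmul a x =>
    induction t with
    | zero => simp
    | add t t' ht ht' =>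
      simp only [map_add, TensorProduct.tmul_add] at ht ht' ⊢
      rw [ht, ht']
      abel
    | tmul b y => exact qsh_cons_cons_tmul σ μ a x b y

end Product

/-! ### Associativity -/

section Assoc

variable {σ : V ⊗[K] V →ₗ[K] V ⊗[K] V} {μ : V ⊗[K] V →ₗ[K] V} {ν : V ⊗[K] V →ₗ[K] V}

/-- Associativity of the quantum quasi-shuffle product on words of lengths `i`, `j` and `k`. -/
def QshAssoc (σ : V ⊗[K] V →ₗ[K] V ⊗[K] V) (μ : V ⊗[K] V →ₗ[K] V) (i j k : ℕ) : Prop :=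
  ∀ (x : ⨂[K]^i V) (y : ⨂[K]^j V) (z : ⨂[K]^k V),
    qsh σ μ (qsh σ μ (TensorPower.toTensorAlgebra x ⊗ₜ TensorPower.toTensorAlgebra y) ⊗ₜ
      TensorPower.toTensorAlgebra z) =
    qsh σ μ (TensorPower.toTensorAlgebra x ⊗ₜ
      qsh σ μ (TensorPower.toTensorAlgebra y ⊗ₜ TensorPower.toTensorAlgebra z))

theorem qshHead_mulLetter (a : V) (s : V ⊗[K] TensorAlgebra K V) (z : TensorAlgebra K V) :
    qshHead σ μ (mulLetter ν a s ⊗ₜ z) = mulLetter ν a (qshHead σ μ (s ⊗ₜ z)) := by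
  induction s with
  | zero => simp
  | add s t hs ht => simp only [map_add, TensorProduct.add_tmul, hs, ht]
  | tmul b t => simp

theorem qshFuse_mulLetter
    (hν : ∀ a b c, ν (ν (a ⊗ₜ b) ⊗ₜ c) = ν (a ⊗ₜ ν (b ⊗ₜ c))) (a : V)
    (s t : V ⊗[K] TensorAlgebra K V) :
    qshFuse σ μ ν (mulLetter ν a s ⊗ₜ t) = mulLetter ν a (qshFuse σ μ ν (s ⊗ₜ t)) := by
  induction s with
  | zero => simp
  | add s s' hs hs' => simp only [map_add, TensorProduct.add_tmul, hs, hs']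
  | tmul b x =>
    rw [mulLetter_tmul, qshFuse_tmul, qshFuse_tmul]
    induction qshPass σ μ (x ⊗ₜ t) with
    | zero => simp
    | add s s' hs hs' => simp only [map_add, hs, hs']
    | tmul c y => simp [hν]

/-- Moving the product `b b'` of two letters past `x` amounts to moving `b` and then `b'`. -/
theorem qshPass_mulLetter (hν : MulCompat ν σ) (x : TensorAlgebra K V) (b : V)
    (s : V ⊗[K] TensorAlgebra K V) :
    qshPass σ μ (x ⊗ₜ mulLetter ν b s) =
      qshFuse σ μ ν (tensorBraid σ (x ⊗ₜ b) ⊗ₜ s) := by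
  induction s with
  | zero => simp
  | add s s' hs hs' => simp only [map_add, TensorProduct.tmul_add, hs, hs']
  | tmul b' y =>
    rw [mulLetter_tmul, qshPass_tmul, mulCompat_tensorBraid hν]
    induction tensorBraid σ (x ⊗ₜ b) with
    | zero => simp
    | add s s' hs hs' => simp only [map_add, TensorProduct.add_tmul, hs, hs']
    | tmul c x' =>
      rw [qshFuse_tmul, qshPass_tmul, TensorProduct.assoc_tmul, LinearMap.lTensor_tmul]
      induction tensorBraid σ (x' ⊗ₜ b') with
      | zero => simp
      | add s s' hs hs' => simp only [map_add, TensorProduct.add_tmul, TensorProduct.tmul_add,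
          hs, hs']
      | tmul c' x'' => simp

theorem tensorBraid_toTensorAlgebra (i : ℕ) (x : ⨂[K]^i V) (b : V) :
    tensorBraid σ (TensorPower.toTensorAlgebra x ⊗ₜ b) =
      (TensorPower.toTensorAlgebra (n := i)).lTensor V (letterBraid σ i (x ⊗ₜ b)) :=
  (isCrossHom_toTensorAlgebra σ i).apply x b

variable {i j k : ℕ}

/-- With `≺`, `≻` for `qshHead`, `qshPass`: `(x ≻ s) ≺ z = x ≻ (s ≺ z)`. -/
theorem qshHead_qshPass (h : QshAssoc σ μ i j k) (x : ⨂[K]^i V) (b : V) (y : ⨂[K]^j V)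
    (z : ⨂[K]^k V) :
    qshHead σ μ (qshPass σ μ (TensorPower.toTensorAlgebra x ⊗ₜ
        (b ⊗ₜ TensorPower.toTensorAlgebra y)) ⊗ₜ TensorPower.toTensorAlgebra z) =
      qshPass σ μ (TensorPower.toTensorAlgebra x ⊗ₜ
        qshHead σ μ ((b ⊗ₜ TensorPower.toTensorAlgebra y) ⊗ₜ TensorPower.toTensorAlgebra z)) := by
  rw [qshHead_tmul, qshPass_tmul, qshPass_tmul, tensorBraid_toTensorAlgebra]
  induction letterBraid σ i (x ⊗ₜ b) with
  | zero => simp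
  | add s t hs ht => simp only [map_add, TensorProduct.add_tmul, hs, ht]
  | tmul c x' => simp only [LinearMap.lTensor_tmul, qshHead_tmul, h x' y z]

/-- With `≻` for `qshPass`: `(x ⋈ y) ≻ s = x ≻ (y ≻ s)`. -/
theorem qshPass_qsh (hσ : IsCrossHom (crossTensor σ σ) (crossTensor σ σ) σ)
    (hμ : IsCrossHom (crossTensor σ σ) σ μ) (h : QshAssoc σ μ i j k) (x : ⨂[K]^i V)
    (y : ⨂[K]^j V) (c : V) (z : ⨂[K]^k V) :
    qshPass σ μ (qsh σ μ (TensorPower.toTensorAlgebra x ⊗ₜ TensorPower.toTensorAlgebra y) ⊗ₜ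
        (c ⊗ₜ TensorPower.toTensorAlgebra z)) =
      qshPass σ μ (TensorPower.toTensorAlgebra x ⊗ₜ qshPass σ μ (TensorPower.toTensorAlgebra y ⊗ₜ
        (c ⊗ₜ TensorPower.toTensorAlgebra z))) := by
  rw [qshPass_tmul, qshPass_tmul, (isCrossHom_qsh hσ hμ).apply, crossTensor_tmul,
    tensorBraid_toTensorAlgebra]
  induction letterBraid σ j (y ⊗ₜ c) with
  | zero => simp
  | add s t hs ht => simp only [map_add, TensorProduct.add_tmul, TensorProduct.tmul_add, hs, ht]
  | tmul c' y' =>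
    rw [LinearMap.lTensor_tmul, through_tmul, qshHead_tmul, qshPass_tmul,
      tensorBraid_toTensorAlgebra]
    induction letterBraid σ i (x ⊗ₜ c') with
    | zero => simp
    | add s t hs ht => simp only [map_add, TensorProduct.add_tmul, hs, ht]
    | tmul c'' x' =>
      simp only [LinearMap.lTensor_tmul, TensorProduct.assoc_tmul, qshHead_tmul, h x' y' z]

/-- With `≻`, `∗` for `qshPass`, `qshFuse`: `(x ≻ s) ∗ t = x ≻ (s ∗ t)`. -/
theorem qshFuse_qshPass (hσ : IsCrossHom (crossTensor σ σ) (crossTensor σ σ) σ)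
    (hμ : IsCrossHom (crossTensor σ σ) σ μ) (hν : MulCompat ν σ)
    (h : QshAssoc σ μ i j k) (x : ⨂[K]^i V) (b : V)
    (y : ⨂[K]^j V) (c : V) (z : ⨂[K]^k V) :
    qshFuse σ μ ν (qshPass σ μ (TensorPower.toTensorAlgebra x ⊗ₜ
        (b ⊗ₜ TensorPower.toTensorAlgebra y)) ⊗ₜ (c ⊗ₜ TensorPower.toTensorAlgebra z)) =
      qshPass σ μ (TensorPower.toTensorAlgebra x ⊗ₜ qshFuse σ μ ν
        ((b ⊗ₜ TensorPower.toTensorAlgebra y) ⊗ₜ (c ⊗ₜ TensorPower.toTensorAlgebra z))) := by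
  rw [qshFuse_tmul, qshPass_mulLetter hν, qshPass_tmul, tensorBraid_toTensorAlgebra]
  induction letterBraid σ i (x ⊗ₜ b) with
  | zero => simp
  | add s t hs ht => simp only [map_add, TensorProduct.add_tmul, hs, ht]
  | tmul b' x' =>
    rw [LinearMap.lTensor_tmul, qshHead_tmul, qshFuse_tmul, qshFuse_tmul,
      qshPass_qsh hσ hμ h]

/-- The quantum quasi-shuffle product of a braided algebra is associative, by induction on the total
length of the three words. -/
theorem qshAssoc (hσ : IsCrossHom (crossTensor σ σ) (crossTensor σ σ) σ)
    (hμ : IsCrossHom (crossTensor σ σ) σ μ) (hμ' : MulCompat μ σ)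
    (hassoc : ∀ a b c, μ (μ (a ⊗ₜ b) ⊗ₜ c) = μ (a ⊗ₜ μ (b ⊗ₜ c))) (n : ℕ) :
    ∀ i j k, i + j + k = n → QshAssoc σ μ i j k := by
  induction n using Nat.strong_induction_on with
  | _ n ih =>
    intro i j k hn x y z
    match i, j, k with
    | 0, j, k =>
      obtain ⟨r, rfl⟩ := (TensorPower.algebraMap₀ (R := K) (M := V)).surjective x
      simp only [toTensorAlgebra_algebraMap₀, ← TensorProduct.smul_tmul', map_smul, qsh_one_left]
    | i, 0, k =>
      obtain ⟨r, rfl⟩ := (TensorPower.algebraMap₀ (R := K) (M := V)).surjective y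
      simp only [toTensorAlgebra_algebraMap₀, ← TensorProduct.smul_tmul', TensorProduct.tmul_smul,
        map_smul, qsh_one_left, qsh_one_right]
    | i, j, 0 =>
      obtain ⟨r, rfl⟩ := (TensorPower.algebraMap₀ (R := K) (M := V)).surjective z
      simp only [toTensorAlgebra_algebraMap₀, TensorProduct.tmul_smul, map_smul, qsh_one_right]
    | i + 1, j + 1, k + 1 =>
      obtain ⟨x, rfl⟩ := (headEquiv K V i).surjective x
      obtain ⟨y, rfl⟩ := (headEquiv K V j).surjective y
      obtain ⟨z, rfl⟩ := (headEquiv K V k).surjective z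
      induction x with
      | zero => simp
      | add s t hs ht => simp only [map_add, TensorProduct.add_tmul, hs, ht]
      | tmul a u =>
        induction y with
        | zero => simp
        | add s t hs ht => simp only [map_add, TensorProduct.add_tmul, TensorProduct.tmul_add, hs,
            ht]
        | tmul b v =>
          induction z with
          | zero => simp
          | add s t hs ht => simp only [map_add, TensorProduct.tmul_add, hs, ht]
          | tmul c w =>
            have hcons : ∀ (m : ℕ) (a : V) (u : ⨂[K]^m V),
                TensorPower.toTensorAlgebra (headEquiv K V m (a ⊗ₜ u)) =
                  consMap K V (a ⊗ₜ TensorPower.toTensorAlgebra u) :=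
              fun m a u => toTensorAlgebra_headEquiv m a u
            have h1 := ih _ (by omega) i (j + 1) (k + 1) rfl u (headEquiv K V j (b ⊗ₜ v))
              (headEquiv K V k (c ⊗ₜ w))
            have h2 := qshHead_qshPass (ih _ (by omega) (i + 1) j (k + 1) rfl)
              (headEquiv K V i (a ⊗ₜ u)) b v (headEquiv K V k (c ⊗ₜ w))
            have h3 := qshHead_qshPass (ih _ (by omega) i j (k + 1) rfl)
              u b v (headEquiv K V k (c ⊗ₜ w))
            have h4 := qshPass_qsh hσ hμ (ih _ (by omega) (i + 1) (j + 1) k rfl)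
              (headEquiv K V i (a ⊗ₜ u)) (headEquiv K V j (b ⊗ₜ v)) c w
            have h5 := qshPass_qsh hσ hμ (ih _ (by omega) i (j + 1) k rfl)
              u (headEquiv K V j (b ⊗ₜ v)) c w
            have h6 := qshFuse_qshPass hσ hμ hμ' (ih _ (by omega) (i + 1) j k rfl)
              (headEquiv K V i (a ⊗ₜ u)) b v c w
            have h7 := qshFuse_qshPass hσ hμ hμ' (ih _ (by omega) i j k rfl) u b v c w
            simp only [hcons] at h1 h2 h3 h4 h5 h6 h7 ⊢
            generalize (TensorPower.toTensorAlgebra u : TensorAlgebra K V) = u at *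
            generalize (TensorPower.toTensorAlgebra v : TensorAlgebra K V) = v at *
            generalize (TensorPower.toTensorAlgebra w : TensorAlgebra K V) = w at *
            obtain ⟨s, hs, hxy⟩ : ∃ s, s = _ ∧ _ = consMap K V s :=
              ⟨_, rfl, qsh_consMap_consMap σ μ (a ⊗ₜ u) (b ⊗ₜ v)⟩
            obtain ⟨t, ht, hyz⟩ : ∃ t, t = _ ∧ _ = consMap K V t :=
              ⟨_, rfl, qsh_consMap_consMap σ μ (b ⊗ₜ v) (c ⊗ₜ w)⟩
            -- `h1`, ..., `h7` are instances of associativity in smaller total length; with them,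
            -- each of the seven terms on the left is matched with one on the right
            have e1 : qshHead σ μ (qshHead σ μ ((a ⊗ₜ u) ⊗ₜ consMap K V (b ⊗ₜ v)) ⊗ₜ
                consMap K V (c ⊗ₜ w)) = qshHead σ μ ((a ⊗ₜ u) ⊗ₜ
                  qsh σ μ (consMap K V (b ⊗ₜ v) ⊗ₜ consMap K V (c ⊗ₜ w))) := by
              rw [qshHead_tmul, qshHead_tmul, qshHead_tmul, h1]
            have e3 : qshHead σ μ (qshFuse σ μ μ ((a ⊗ₜ u) ⊗ₜ (b ⊗ₜ v)) ⊗ₜ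
                consMap K V (c ⊗ₜ w)) = qshFuse σ μ μ ((a ⊗ₜ u) ⊗ₜ
                  qshHead σ μ ((b ⊗ₜ v) ⊗ₜ consMap K V (c ⊗ₜ w))) := by
              rw [qshFuse_tmul, qshFuse_tmul, qshHead_mulLetter, h3]
            have e5 : qshFuse σ μ μ (qshHead σ μ ((a ⊗ₜ u) ⊗ₜ consMap K V (b ⊗ₜ v)) ⊗ₜ
                (c ⊗ₜ w)) = qshFuse σ μ μ ((a ⊗ₜ u) ⊗ₜ
                  qshPass σ μ (consMap K V (b ⊗ₜ v) ⊗ₜ (c ⊗ₜ w))) := by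
              rw [qshHead_tmul, qshFuse_tmul, qshFuse_tmul, h5]
            have e7 : qshFuse σ μ μ (qshFuse σ μ μ ((a ⊗ₜ u) ⊗ₜ (b ⊗ₜ v)) ⊗ₜ (c ⊗ₜ w)) =
                qshFuse σ μ μ ((a ⊗ₜ u) ⊗ₜ qshFuse σ μ μ ((b ⊗ₜ v) ⊗ₜ (c ⊗ₜ w))) := by
              rw [qshFuse_tmul σ μ μ a u, qshFuse_tmul σ μ μ a u, qshFuse_mulLetter hassoc, h7]
            rw [hxy, qsh_consMap_consMap, ← hxy, hyz, qsh_consMap_consMap σ μ _ t, ← hyz, hs, ht]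
            simp only [TensorProduct.add_tmul, TensorProduct.tmul_add, map_add]
            rw [e1, h2, e3, h4, e5, h6, e7]
            abel

end Assoc
end QuasiShuffle

namespace QuasiShuffle

variable {K : Type*} [Field K]

section Flip

variable {V : Type*} [AddCommGroup V] [Module K V]

/-! ### The case of the flip -/

theorem tensorBraid_comm (t : TensorAlgebra K V) (v : V) :
    tensorBraid (TensorProduct.comm K V V).toLinearMap (t ⊗ₜ v) = v ⊗ₜ t := by
  induction t using tensorAlgebra_cons_induction with
  | add s t hs ht => rw [TensorProduct.add_tmul, map_add, hs, ht, TensorProduct.tmul_add]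
  | smul r t ht => rw [← TensorProduct.smul_tmul', map_smul, ht, TensorProduct.tmul_smul]
  | one => exact tensorBraid_one _ v
  | cons a t ht => rw [tensorBraid_cons, ht]; simp

variable (μ ν : V ⊗[K] V →ₗ[K] V)

theorem qshPass_comm_tmul (x : TensorAlgebra K V) (b : V) (y : TensorAlgebra K V) :
    qshPass (TensorProduct.comm K V V).toLinearMap μ (x ⊗ₜ (b ⊗ₜ y)) =
      b ⊗ₜ qsh (TensorProduct.comm K V V).toLinearMap μ (x ⊗ₜ y) := by
  rw [qshPass_tmul, tensorBraid_comm, qshHead_tmul]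

theorem qshFuse_comm_tmul (a : V) (x : TensorAlgebra K V) (b : V) (y : TensorAlgebra K V) :
    qshFuse (TensorProduct.comm K V V).toLinearMap μ ν ((a ⊗ₜ x) ⊗ₜ (b ⊗ₜ y)) =
      ν (a ⊗ₜ b) ⊗ₜ qsh (TensorProduct.comm K V V).toLinearMap μ (x ⊗ₜ y) := by
  rw [qshFuse_tmul, qshPass_comm_tmul, mulLetter_tmul]

/-- The recursion of the (commutative) quasi-shuffle product. -/
theorem qsh_comm_cons_cons (a : V) (x : TensorAlgebra K V) (b : V) (y : TensorAlgebra K V) :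
    qsh (TensorProduct.comm K V V).toLinearMap μ
        ((TensorAlgebra.ι K a * x) ⊗ₜ (TensorAlgebra.ι K b * y)) =
      TensorAlgebra.ι K a * qsh (TensorProduct.comm K V V).toLinearMap μ
        (x ⊗ₜ (TensorAlgebra.ι K b * y)) +
      TensorAlgebra.ι K b * qsh (TensorProduct.comm K V V).toLinearMap μ
        ((TensorAlgebra.ι K a * x) ⊗ₜ y) +
      TensorAlgebra.ι K (μ (a ⊗ₜ b)) *
        qsh (TensorProduct.comm K V V).toLinearMap μ (x ⊗ₜ y) := by
  rw [qsh_cons_cons_tmul, qshHead_tmul, qshPass_comm_tmul, qshFuse_comm_tmul, map_add, map_add,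
    consMap_tmul, consMap_tmul, consMap_tmul]

variable {μ}

theorem qsh_comm (hμ : ∀ a b, μ (a ⊗ₜ b) = μ (b ⊗ₜ a)) (x y : TensorAlgebra K V) :
    qsh (TensorProduct.comm K V V).toLinearMap μ (x ⊗ₜ y) =
      qsh (TensorProduct.comm K V V).toLinearMap μ (y ⊗ₜ x) := by
  induction x using tensorAlgebra_cons_induction generalizing y with
  | add s t hs ht => rw [TensorProduct.add_tmul, TensorProduct.tmul_add, map_add, map_add, hs, ht]
  | smul r t ht => rw [← TensorProduct.smul_tmul', TensorProduct.tmul_smul, map_smul, map_smul, ht]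
  | one => rw [qsh_one_left, qsh_one_right]
  | cons a x hx =>
    induction y using tensorAlgebra_cons_induction with
    | add s t hs ht => rw [TensorProduct.add_tmul, TensorProduct.tmul_add, map_add, map_add, hs, ht]
    | smul r t ht =>
      rw [← TensorProduct.smul_tmul', TensorProduct.tmul_smul, map_smul, map_smul, ht]
    | one => rw [qsh_one_left, qsh_one_right]
    | cons b y hy =>
      rw [qsh_comm_cons_cons, qsh_comm_cons_cons, hx, hx, hy, hμ a b]
      abel

end Flip

/-! ### The Rota-Baxter algebra `A ⊗ T(A)` -/

section Algebra

variable {A : Type*} [Ring A] [Algebra K A] {σ : A ⊗[K] A →ₗ[K] A ⊗[K] A} {c : K}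

namespace IsUnitalBraidedAlgebra

theorem isCrossHom (hσ : IsUnitalBraidedAlgebra σ) :
    IsCrossHom (crossTensor σ σ) (crossTensor σ σ) σ :=
  isCrossHom_of_yangBaxter hσ.yang_baxter

theorem isCrossHom_mul (hσ : IsUnitalBraidedAlgebra σ) :
    IsCrossHom (crossTensor σ σ) σ (LinearMap.mul' K A) := by
  rw [isCrossHom_iff]
  intro t v
  induction t with
  | zero => simp
  | add s t hs ht => simp only [map_add, TensorProduct.add_tmul, hs, ht]
  | tmul a b => exact (LinearMap.congr_fun hσ.mul_left (a ⊗ₜ (b ⊗ₜ v))).symm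

theorem mulCompat (hσ : IsUnitalBraidedAlgebra σ) : MulCompat (LinearMap.mul' K A) σ :=
  fun x a a' => (LinearMap.congr_fun hσ.mul_right (x ⊗ₜ (a ⊗ₜ a'))).symm

end IsUnitalBraidedAlgebra

theorem MulCompat.smul {V : Type*} [AddCommGroup V] [Module K V] {σ : V ⊗[K] V →ₗ[K] V ⊗[K] V}
    {μ : V ⊗[K] V →ₗ[K] V} (h : MulCompat μ σ) (c : K) : MulCompat (c • μ) σ := by
  intro x a a'
  rw [LinearMap.smul_apply, TensorProduct.tmul_smul, map_smul, h, LinearMap.rTensor_smul,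
    LinearMap.smul_apply]

theorem qshFuse_smul {V : Type*} [AddCommGroup V] [Module K V] (σ : V ⊗[K] V →ₗ[K] V ⊗[K] V)
    (μ ν : V ⊗[K] V →ₗ[K] V) (c : K) : qshFuse σ μ (c • ν) = c • qshFuse σ μ ν := by
  rw [qshFuse, LinearMap.rTensor_smul, LinearMap.smul_comp, qshFuse]

theorem diamond_eq_qshFuse (σ : A ⊗[K] A →ₗ[K] A ⊗[K] A) (c : K) :
    diamond σ c = qshFuse σ (c • LinearMap.mul' K A) (LinearMap.mul' K A) := by
  refine TensorProduct.ext' fun s t => ?_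
  induction s with
  | zero => simp
  | add s s' hs hs' => simp only [map_add, TensorProduct.add_tmul, hs, hs']
  | tmul a x =>
    have h : diamond σ c ((a ⊗ₜ x) ⊗ₜ t) =
      TensorProduct.map (LinearMap.mul' K A) (qsh σ (c • LinearMap.mul' K A))
        ((TensorProduct.assoc K A A _).symm (a ⊗ₜ through (tensorBraid σ) _ (x ⊗ₜ t))) := rfl
    have h' : qshPass σ (c • LinearMap.mul' K A) (x ⊗ₜ t) =
      (qsh σ (c • LinearMap.mul' K A)).lTensor A (through (tensorBraid σ) _ (x ⊗ₜ t)) := rfl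
    rw [h, qshFuse_tmul, h']
    induction through (tensorBraid σ) (TensorAlgebra K A) (x ⊗ₜ t) with
    | zero => simp
    | add s s' hs hs' => simp only [map_add, TensorProduct.tmul_add, hs, hs']
    | tmul b y => simp

theorem rbOp_apply (s : A ⊗[K] TensorAlgebra K A) : rbOp K A s = 1 ⊗ₜ consMap K A s := rfl

theorem diamond_one_tmul (x : TensorAlgebra K A) (s : A ⊗[K] TensorAlgebra K A) :
    diamond σ c ((1 ⊗ₜ x) ⊗ₜ s) = qshPass σ (c • LinearMap.mul' K A) (x ⊗ₜ s) := by
  rw [diamond_eq_qshFuse, qshFuse_tmul]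
  induction qshPass σ (c • LinearMap.mul' K A) (x ⊗ₜ s) with
  | zero => simp
  | add s t hs ht => rw [map_add, hs, ht]
  | tmul b y => simp

theorem diamond_tmul_one (h : FixesLetter 1 σ) (s : A ⊗[K] TensorAlgebra K A)
    (y : TensorAlgebra K A) :
    diamond σ c (s ⊗ₜ (1 ⊗ₜ y)) = qshHead σ (c • LinearMap.mul' K A) (s ⊗ₜ y) := by
  induction s with
  | zero => simp
  | add s t hs ht => simp only [TensorProduct.add_tmul, map_add, hs, ht]
  | tmul a x =>
    rw [diamond_eq_qshFuse, qshFuse_tmul, qshPass_tmul, fixesLetter_tensorBraid h]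
    simp

theorem diamond_assoc (hσ : IsUnitalBraidedAlgebra σ) (c : K) (x y z : A ⊗[K] TensorAlgebra K A) :
    diamond σ c (diamond σ c (x ⊗ₜ y) ⊗ₜ z) = diamond σ c (x ⊗ₜ diamond σ c (y ⊗ₜ z)) := by
  rw [diamond_eq_qshFuse]
  induction x with
  | zero => simp
  | add s t hs ht => simp only [TensorProduct.add_tmul, map_add, hs, ht]
  | tmul a x =>
    rw [qshFuse_tmul, qshFuse_tmul, qshFuse_mulLetter fun a b c => by simp [mul_assoc]]
    congr 1
    induction y with
    | zero => simp
    | add s t hs ht => simp only [TensorProduct.add_tmul, TensorProduct.tmul_add, map_add, hs, ht]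
    | tmul b y =>
      induction z with
      | zero => simp
      | add s t hs ht => simp only [TensorProduct.tmul_add, map_add, hs, ht]
      | tmul d z =>
        induction x using tensorAlgebra_induction with
        | add s t hs ht => simp only [TensorProduct.add_tmul, map_add, hs, ht]
        | homogeneous i x =>
          induction y using tensorAlgebra_induction with
          | add s t hs ht => simp only [TensorProduct.add_tmul, TensorProduct.tmul_add, map_add, hs,
              ht]
          | homogeneous j y =>
            induction z using tensorAlgebra_induction with
            | add s t hs ht => simp only [TensorProduct.tmul_add, map_add, hs, ht]
            | homogeneous k z =>
              have hμ := hσ.isCrossHom_mul.smul c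
              exact qshFuse_qshPass hσ.isCrossHom hμ hσ.mulCompat
                (qshAssoc hσ.isCrossHom hμ (hσ.mulCompat.smul c)
                  (fun a b d => by simp [mul_assoc]) _ i j k rfl) x b y d z

theorem isRotaBaxter_diamond (hσ : IsUnitalBraidedAlgebra σ) (c : K) :
    IsRotaBaxter c (diamond σ c) (rbOp K A) where
  assoc := diamond_assoc hσ c
  rota_baxter s t := by
    simp only [rbOp_apply]
    rw [diamond_one_tmul, diamond_one_tmul, diamond_tmul_one hσ.apply_one, qshPass_tmul,
      fixesLetter_tensorBraid hσ.apply_one, qshHead_tmul, qsh_consMap_consMap, qshFuse_smul,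
      ← diamond_eq_qshFuse]
    simp only [map_add, map_smul, LinearMap.smul_apply, TensorProduct.tmul_add,
      TensorProduct.tmul_smul]

theorem diamond_one_left (σ : A ⊗[K] A →ₗ[K] A ⊗[K] A) (c : K) (x : A ⊗[K] TensorAlgebra K A) :
    diamond σ c (((1 : A) ⊗ₜ (1 : TensorAlgebra K A)) ⊗ₜ x) = x := by
  rw [diamond_one_tmul]
  induction x with
  | zero => simp
  | add s t hs ht => rw [TensorProduct.tmul_add, map_add, hs, ht]
  | tmul b y => rw [qshPass_tmul, tensorBraid_one, qshHead_tmul, qsh_one_left]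

theorem diamond_one_right (h : FixesLetter 1 σ) (c : K) (x : A ⊗[K] TensorAlgebra K A) :
    diamond σ c (x ⊗ₜ ((1 : A) ⊗ₜ (1 : TensorAlgebra K A))) = x := by
  rw [diamond_tmul_one h]
  induction x with
  | zero => simp
  | add s t hs ht => rw [TensorProduct.add_tmul, map_add, hs, ht]
  | tmul b y => rw [qshHead_tmul, qsh_one_right]

end Algebra

/-! ### Freeness in the commutative case -/

section Free

variable {A : Type*} [Ring A] [Algebra K A]

theorem diamond_comm_tmul (c : K) (a b : A) (x y : TensorAlgebra K A) :
    diamond (TensorProduct.comm K A A).toLinearMap c ((a ⊗ₜ x) ⊗ₜ (b ⊗ₜ y)) =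
      (a * b) ⊗ₜ qsh (TensorProduct.comm K A A).toLinearMap (c • LinearMap.mul' K A)
        (x ⊗ₜ y) := by
  rw [diamond_eq_qshFuse, qshFuse_comm_tmul, LinearMap.mul'_apply]

theorem diamond_comm (hA : ∀ a b : A, a * b = b * a) (c : K) (s t : A ⊗[K] TensorAlgebra K A) :
    diamond (TensorProduct.comm K A A).toLinearMap c (s ⊗ₜ t) =
      diamond (TensorProduct.comm K A A).toLinearMap c (t ⊗ₜ s) := by
  induction s with
  | zero => simp
  | add s s' hs hs' => simp only [TensorProduct.add_tmul, TensorProduct.tmul_add, map_add, hs, hs']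
  | tmul a x =>
    induction t with
    | zero => simp
    | add t t' ht ht' =>
      simp only [TensorProduct.add_tmul, TensorProduct.tmul_add, map_add, ht, ht']
    | tmul b y =>
      rw [diamond_comm_tmul, diamond_comm_tmul, hA a b, qsh_comm fun a b => by simp [hA a b]]

variable {B : Type*} [CommRing B] [Algebra K B]

/-- The linear map `T(A) → B` sending a word `a₁ a₂ ⋯ aₙ` to the nested expression
`Q (f a₁ * Q (f a₂ * ⋯ Q (f aₙ)))`. It is obtained by letting `T(A)` act on `B`, the letter `a`
acting by `t ↦ Q (f a * t)`, and evaluating this action at `1`. -/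
noncomputable def nestedMap (Q : B →ₗ[K] B) (f : A →ₗ[K] B) : TensorAlgebra K A →ₗ[K] B :=
  LinearMap.applyₗ (1 : B) ∘ₗ
    (TensorAlgebra.lift K (M := A) (A := Module.End K B)
      (((LinearMap.mul K B).compr₂ Q) ∘ₗ f)).toLinearMap

theorem nestedMap_one (Q : B →ₗ[K] B) (f : A →ₗ[K] B) : nestedMap Q f 1 = 1 := by
  simp [nestedMap]

theorem nestedMap_cons (Q : B →ₗ[K] B) (f : A →ₗ[K] B) (a : A) (t : TensorAlgebra K A) :
    nestedMap Q f (TensorAlgebra.ι K a * t) = Q (f a * nestedMap Q f t) := by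
  simp [nestedMap]

/-- Nested expressions in a commutative Rota-Baxter algebra multiply by the quasi-shuffle
product. -/
theorem nestedMap_qsh {c : K} {Q : B →ₗ[K] B} (hQ : IsRotaBaxter c (LinearMap.mul' K B) Q)
    (f : A →ₐ[K] B) (x y : TensorAlgebra K A) :
    nestedMap Q f.toLinearMap (qsh (TensorProduct.comm K A A).toLinearMap (c • LinearMap.mul' K A)
      (x ⊗ₜ y)) = nestedMap Q f.toLinearMap x * nestedMap Q f.toLinearMap y := by
  induction x using tensorAlgebra_cons_induction generalizing y with
  | add s t hs ht => rw [TensorProduct.add_tmul, map_add, map_add, hs, ht, map_add, add_mul]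
  | smul r t ht => rw [← TensorProduct.smul_tmul', map_smul, map_smul, ht, map_smul, smul_mul_assoc]
  | one => rw [qsh_one_left, nestedMap_one, one_mul]
  | cons a x hx =>
    induction y using tensorAlgebra_cons_induction with
    | add s t hs ht => rw [TensorProduct.tmul_add, map_add, map_add, hs, ht, map_add, mul_add]
    | smul r t ht => rw [TensorProduct.tmul_smul, map_smul, map_smul, ht, map_smul, mul_smul_comm]
    | one => rw [qsh_one_right, nestedMap_one, mul_one]
    | cons b y hy =>
      have h := hQ.rota_baxter (f a * nestedMap Q f.toLinearMap x)
        (f b * nestedMap Q f.toLinearMap y)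
      simp only [LinearMap.mul'_apply] at h
      rw [qsh_comm_cons_cons, map_add, map_add, nestedMap_cons, nestedMap_cons, nestedMap_cons,
        hx, hx, hy, nestedMap_cons, nestedMap_cons]
      simp only [AlgHom.toLinearMap_apply, LinearMap.smul_apply, LinearMap.mul'_apply, map_smul,
        map_mul, smul_mul_assoc]
      rw [h]
      congr 2 <;> congr 1 <;> ring

theorem existsUnique_rotaBaxter_hom {c : K} {Q : B →ₗ[K] B}
    (hQ : IsRotaBaxter c (LinearMap.mul' K B) Q) (f : A →ₐ[K] B) :
    ∃! g : A ⊗[K] TensorAlgebra K A →ₗ[K] B,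
      g (1 ⊗ₜ 1) = 1 ∧
      (∀ x y, g (diamond (TensorProduct.comm K A A).toLinearMap c (x ⊗ₜ y)) = g x * g y) ∧
      (∀ x, g (rbOp K A x) = Q (g x)) ∧
      ∀ a : A, g (a ⊗ₜ 1) = f a := by
  refine ⟨LinearMap.mul' K B ∘ₗ TensorProduct.map f.toLinearMap (nestedMap Q f.toLinearMap),
    ⟨?_, ?_, ?_, ?_⟩, ?_⟩
  · simp [nestedMap_one]
  · intro s t
    induction s with
    | zero => simp
    | add s s' hs hs' => rw [TensorProduct.add_tmul, map_add, map_add, hs, hs', map_add, add_mul]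
    | tmul a x =>
      induction t with
      | zero => simp
      | add t t' ht ht' => rw [TensorProduct.tmul_add, map_add, map_add, ht, ht', map_add, mul_add]
      | tmul b y =>
        rw [diamond_comm_tmul]
        simp only [LinearMap.comp_apply, TensorProduct.map_tmul, LinearMap.mul'_apply,
          nestedMap_qsh hQ, AlgHom.toLinearMap_apply, map_mul]
        ring
  · intro s
    induction s with
    | zero => simp
    | add s s' hs hs' => rw [map_add, map_add, hs, hs', map_add, map_add]
    | tmul a x => simp [rbOp_apply, nestedMap_cons]
  · intro a
    simp [nestedMap_one]
  · rintro g ⟨-, hmul, hrb, hf⟩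
    refine TensorProduct.ext' fun a t => ?_
    induction t using tensorAlgebra_cons_induction generalizing a with
    | add s t hs ht => rw [TensorProduct.tmul_add, map_add, map_add, hs, ht]
    | smul r t ht => rw [TensorProduct.tmul_smul, map_smul, map_smul, ht]
    | one => simp [hf, nestedMap_one]
    | cons b t ht =>
      -- `a ⊗ b t` is the product of `a ⊗ 1` and `P (b ⊗ t)`
      have h := hmul (a ⊗ₜ 1) (rbOp K A (b ⊗ₜ t))
      rw [hrb, hf, ht, rbOp_apply, consMap_tmul, diamond_comm_tmul, mul_one, qsh_one_left] at h
      rw [h]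
      simp [nestedMap_cons]

end Free

end QuasiShuffle

theorem theorem2p4 {K : Type*} [Field K] {A : Type*} [Ring A] [Algebra K A]
    (σ : A ⊗[K] A →ₗ[K] A ⊗[K] A) (hσ : QuasiShuffle.IsUnitalBraidedAlgebra σ) (c : K) :
    QuasiShuffle.IsRotaBaxter c (QuasiShuffle.diamond σ c) (QuasiShuffle.rbOp K A) ∧
    (∀ x : A ⊗[K] TensorAlgebra K A,
      QuasiShuffle.diamond σ c (((1 : A) ⊗ₜ (1 : TensorAlgebra K A)) ⊗ₜ x) = x ∧
      QuasiShuffle.diamond σ c (x ⊗ₜ ((1 : A) ⊗ₜ (1 : TensorAlgebra K A))) = x) ∧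
    -- for commutative `A` and the flip, this is the free commutative Rota-Baxter algebra on `A`
    ((∀ a b : A, a * b = b * a) → σ = (TensorProduct.comm K A A).toLinearMap →
      (∀ x y : A ⊗[K] TensorAlgebra K A,
        QuasiShuffle.diamond σ c (x ⊗ₜ y) = QuasiShuffle.diamond σ c (y ⊗ₜ x)) ∧
      (∀ a b : A, QuasiShuffle.diamond σ c ((a ⊗ₜ 1) ⊗ₜ (b ⊗ₜ 1)) = (a * b) ⊗ₜ 1) ∧
      ∀ {B : Type*} [CommRing B] [Algebra K B] (Q : B →ₗ[K] B),
        QuasiShuffle.IsRotaBaxter c (LinearMap.mul' K B) Q →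
        ∀ f : A →ₐ[K] B, ∃! g : A ⊗[K] TensorAlgebra K A →ₗ[K] B,
          g (1 ⊗ₜ 1) = 1 ∧
          (∀ x y, g (QuasiShuffle.diamond σ c (x ⊗ₜ y)) = g x * g y) ∧
          (∀ x, g (QuasiShuffle.rbOp K A x) = Q (g x)) ∧
          ∀ a : A, g (a ⊗ₜ 1) = f a) := by
  refine ⟨QuasiShuffle.isRotaBaxter_diamond hσ c, fun x => ⟨QuasiShuffle.diamond_one_left σ c x,
    QuasiShuffle.diamond_one_right hσ.apply_one c x⟩, ?_⟩
  rintro hA rfl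
  refine ⟨QuasiShuffle.diamond_comm hA c, fun a b => ?_, fun Q hQ f =>
    QuasiShuffle.existsUnique_rotaBaxter_hom hQ f⟩
  rw [QuasiShuffle.diamond_comm_tmul, QuasiShuffle.qsh_one_left]
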